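/- Let $n\ge 2$ and $p\ge 1$. A weight is a nonnegative locally Lebesgue-integrable function $w$ on $\mathbb R^n$; we write $d\mu=w\,dx$ and let $Q$ range over open cubes with sides parallel to the axes. The weight $w$ is $p$-admissible if $0<\mu(Q)<\infty$ for all $Q$ and there is a constant $C$ such that, for every $Q$, $\mu(2Q)\le C\mu(Q)$ and $$\frac1{\mu(Q)}\int_Q|u-u_Q|\,d\mu\le C\,(\operatorname{diam}Q)\Big(\frac1{\mu(Q)}\int_Q|\nabla u|^p\,d\mu\Big)^{1/p},\qquad u_Q=\frac1{\mu(Q)}\int_Q u\,d\mu,$$ for every bounded $u\in C^\infty(Q)$. For $\Omega\subset\mathbb R^n$ open, a locally Lebesgue-integrable function $u$ on $\Omega$ is weakly differentiable if for each $j$ there is a locally Lebesgue-integrable $v_j$ with $\int_\Omega u\,\partial_j\varphi\,dx=-\int_\Omega v_j\varphi\,dx$ for all $\varphi\in C_0^\infty(\Omega)$; put $\nabla u=(v_1,\dots,v_n)$. Let $\|u\|_{1,p}=\big(\int_\Omega|u|^p\,d\mu+\int_\Omega|\nabla u|^p\,d\mu\big)^{1/p}$. The space $W^{1,p}(\Omega;w\,dx)$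 consists of all weakly differentiable $u$ on $\Omega$ with $\|u\|_{1,p}<\infty$, normed by $\|\cdot\|_{1,p}$. The space $H^{1,p}(\Omega;w\,dx)$ is the completion of $\{u\in C^\infty(\Omega):\|u\|_{1,p}<\infty\}$ in $\|\cdot\|_{1,p}$, its elements being identified with their limits in $L^p(\Omega;w\,dx)$: $u\in H^{1,p}$ if and only if $u\in L^p(\Omega;\mu)$ and there are $v\in L^p(\Omega;\mu)^n$ and smooth $u_k$ on $\Omega$ with $\|u_k\|_{1,p}<\infty$, $u_k\to u$ in $L^p(\Omega;\mu)$ and $\nabla u_k\to v$ in $L^p(\Omega;\mu)^n$. **A.** For every $\gamma>-n$ the weight $w(x)=|x|^\gamma$ is $p$-admissible on $\mathbb R^n$, and the function $|x|^{1-n}$ is not in $W^{1,p}(B(0,1);w\,dx)$. If moreover $\gamma>n(p-1)$, then $|x|^{1-n}\in H^{1,p}(B(0,1);w\,dx)$. **B.** For every $\gamma>n(p-1)$ the weight $w(x)=|x|^\gamma$ is $p$-admissible on $\mathbb R^n$ and 1. $W^{1,p}(\mathbb R^n;w\,dx)$ is not a Banach space; 2. there is $u\in H^{1,p}(\mathbb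 R^n;w\,dx)$ that is not weakly differentiable on $\mathbb R^n$; in fact, for every $\eta\in C_0^\infty(\mathbb R^n)$ with $\eta=1$ in a neighbourhood of $0$, the function $u(x)=\eta(x)|x|^{1-n}$ is such a function; 3. $\{0\}$ is not removable for $W^{1,p}$: there is a function in $W^{1,p}(\mathbb R^n\setminus\{0\};w\,dx)$ that does not coincide a.e. with any function in $W^{1,p}(\mathbb R^n;w\,dx)$. In particular, for every $p\ge 1$ and $n\ge 2$ there is a $p$-admissible weight on $\mathbb R^n$ with the properties 1, 2 and 3. -/

import Mathlib

open MeasureTheory Filter Topology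
open scoped ENNReal NNReal ContDiff Gradient

noncomputable section

namespace WeightedSobolev

/-- Euclidean space of dimension `n`. -/
abbrev Rn (n : ℕ) : Type := EuclideanSpace ℝ (Fin n)

/-- The measure `dμ = w dx`. -/
def weightMeasure {n : ℕ} (w : Rn n → ℝ) : Measure (Rn n) :=
  volume.withDensity (fun x => ENNReal.ofReal (w x))

/-- The open cube with centre `c`, side length `l` and sides parallel to the axes. -/
def cube {n : ℕ} (c : Rn n) (l : ℝ) : Set (Rn n) := {x | ∀ i, |x i - c i| < l / 2}

/-- A weight: a nonnegative locally Lebesgue-integrable function. -/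
def IsWeight {n : ℕ} (w : Rn n → ℝ) : Prop :=
  (∀ x, 0 ≤ w x) ∧ LocallyIntegrable w volume

/-- All cubes have positive finite measure. -/
def CubesPosFinite {n : ℕ} (μ : Measure (Rn n)) : Prop :=
  ∀ (c : Rn n) (l : ℝ), 0 < l → 0 < μ (cube c l) ∧ μ (cube c l) < ⊤

/-- Doubling measures on `ℝⁿ`. -/
def IsDoubling {n : ℕ} (μ : Measure (Rn n)) : Prop :=
  CubesPosFinite μ ∧
    ∃ C : ℝ≥0, ∀ (c : Rn n) (l : ℝ), 0 < l → μ (cube c (2 * l)) ≤ C * μ (cube c l)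

/-- The `p`-Poincaré inequality, for every cube `Q` and every bounded `u ∈ C^∞(Q)`.
The right-hand side may be infinite. -/
def HasPoincare {n : ℕ} (p : ℝ) (μ : Measure (Rn n)) : Prop :=
  CubesPosFinite μ ∧
    ∃ C : ℝ≥0, ∀ (c : Rn n) (l : ℝ), 0 < l → ∀ u : Rn n → ℝ,
      ContDiffOn ℝ ∞ u (cube c l) → (∃ M : ℝ, ∀ x ∈ cube c l, |u x| ≤ M) →
      ⨍⁻ x in cube c l, ‖u x - ⨍ y in cube c l, u y ∂μ‖ₑ ∂μ ≤
        C * ENNReal.ofReal (Metric.diam (cube c l)) *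
          (⨍⁻ x in cube c l, ‖∇ u x‖ₑ ^ p ∂μ) ^ (1 / p)

/-- `w` is a `p`-admissible weight. -/
def IsAdmissibleWeight {n : ℕ} (p : ℝ) (w : Rn n → ℝ) : Prop :=
  IsWeight w ∧ IsDoubling (weightMeasure w) ∧ HasPoincare p (weightMeasure w)

/-- `v` is a weak `j`-th partial derivative of `u` on the open set `Ω`; local integrability and
the integration by parts are with respect to Lebesgue measure. -/
structure IsWeakPartialDeriv {n : ℕ} (Ω : Set (Rn n)) (j : Fin n) (u v : Rn n → ℝ) : Prop where
  locallyIntegrableOn : LocallyIntegrableOn u Ω volume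
  locallyIntegrableOn_deriv : LocallyIntegrableOn v Ω volume
  integral_eq : ∀ φ : Rn n → ℝ, ContDiff ℝ ∞ φ → HasCompactSupport φ → tsupport φ ⊆ Ω →
    ∫ x in Ω, u x * fderiv ℝ φ x (EuclideanSpace.single j 1) = - ∫ x in Ω, v x * φ x

/-- `u` is weakly differentiable on the open set `Ω`. -/
def IsWeaklyDifferentiable {n : ℕ} (Ω : Set (Rn n)) (u : Rn n → ℝ) : Prop :=
  LocallyIntegrableOn u Ω volume ∧ ∀ j, ∃ v : Rn n → ℝ, IsWeakPartialDeriv Ω j u v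

/-- `v` is a weak gradient of `u` on the open set `Ω`. -/
def IsWeakGradient {n : ℕ} (Ω : Set (Rn n)) (u : Rn n → ℝ) (v : Rn n → Rn n) : Prop :=
  LocallyIntegrableOn u Ω volume ∧ ∀ j, IsWeakPartialDeriv Ω j u (fun x => v x j)

/-- The function `u` belongs to `W^{1,p}(Ω; w dx)`: it is weakly differentiable on `Ω`, and `u`
and its weak gradient are `p`-integrable on `Ω` with respect to `w dx`. -/
def MemW {n : ℕ} (p : ℝ) (Ω : Set (Rn n)) (w u : Rn n → ℝ) : Prop :=
  ∃ v : Rn n → Rn n, IsWeakGradient Ω u v ∧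
    MemLp u (ENNReal.ofReal p) ((weightMeasure w).restrict Ω) ∧
    MemLp v (ENNReal.ofReal p) ((weightMeasure w).restrict Ω)

/-- The function `u` belongs to `H^{1,p}(Ω; w dx)`, the completion of
`{u ∈ C^∞(Ω) : ‖u‖_{1,p} < ∞}`, whose elements are identified with their `L^p` limits:
`u` is the `L^p`-limit of smooth functions of finite norm whose gradients converge in `L^p`. -/
def MemH {n : ℕ} (p : ℝ) (Ω : Set (Rn n)) (w u : Rn n → ℝ) : Prop :=
  MemLp u (ENNReal.ofReal p) ((weightMeasure w).restrict Ω) ∧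
  ∃ v : Rn n → Rn n, MemLp v (ENNReal.ofReal p) ((weightMeasure w).restrict Ω) ∧
  ∃ f : ℕ → Rn n → ℝ,
    (∀ k, ContDiffOn ℝ ∞ (f k) Ω ∧
      MemLp (f k) (ENNReal.ofReal p) ((weightMeasure w).restrict Ω) ∧
      MemLp (∇ (f k)) (ENNReal.ofReal p) ((weightMeasure w).restrict Ω)) ∧
    Tendsto (fun k => eLpNorm (fun x => f k x - u x) (ENNReal.ofReal p)
      ((weightMeasure w).restrict Ω)) atTop (𝓝 0) ∧
    Tendsto (fun k => eLpNorm (fun x => ∇ (f k) x - v x) (ENNReal.ofReal p)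
      ((weightMeasure w).restrict Ω)) atTop (𝓝 0)

/-- `E` (a compact null subset of the open set `Ω`) is removable for `W^{1,p}(Ω; w dx)`: every
function in `W^{1,p}(Ω \ E; w dx)` coincides a.e. with a function in `W^{1,p}(Ω; w dx)`. -/
def IsRemovableW {n : ℕ} (p : ℝ) (Ω : Set (Rn n)) (w : Rn n → ℝ) (E : Set (Rn n)) : Prop :=
  ∀ u : Rn n → ℝ, MemW p (Ω \ E) w u →
    ∃ u' : Rn n → ℝ, MemW p Ω w u' ∧ u' =ᵐ[(weightMeasure w).restrict (Ω \ E)] u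

theorem integrableOn_mul_test {n : ℕ} {Ω : Set (Rn n)} {u ψ : Rn n → ℝ}
    (hu : LocallyIntegrableOn u Ω volume) (hψ : Continuous ψ) {K : Set (Rn n)}
    (hK : IsCompact K) (hKΩ : K ⊆ Ω) (h0 : ∀ x, x ∉ K → ψ x = 0) :
    IntegrableOn (fun x => u x * ψ x) Ω volume := by
  have h1 : IntegrableOn (fun x => u x * ψ x) K volume :=
    (hu.integrableOn_compact_subset hKΩ hK).mul_continuousOn hψ.continuousOn hK
  refine IntegrableOn.integrable_of_forall_notMem_eq_zero h1 ?_ |>.integrableOn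
  intro x hx
  simp [h0 x hx]

theorem integrableOn_mul_fderiv {n : ℕ} {Ω : Set (Rn n)} {u φ : Rn n → ℝ}
    (hu : LocallyIntegrableOn u Ω volume) (hφ : ContDiff ℝ ∞ φ) (hc : HasCompactSupport φ)
    (hs : tsupport φ ⊆ Ω) (e : Rn n) :
    IntegrableOn (fun x => u x * fderiv ℝ φ x e) Ω volume := by
  refine integrableOn_mul_test hu ((hφ.continuous_fderiv (by simp)).clm_apply
    continuous_const) hc hs ?_
  intro x hx
  have : fderiv ℝ φ x = 0 := by
    by_contra h
    exact hx (support_fderiv_subset ℝ h)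
  simp [this]

theorem integrableOn_mul_self {n : ℕ} {Ω : Set (Rn n)} {u φ : Rn n → ℝ}
    (hu : LocallyIntegrableOn u Ω volume) (hφ : ContDiff ℝ ∞ φ) (hc : HasCompactSupport φ)
    (hs : tsupport φ ⊆ Ω) : IntegrableOn (fun x => u x * φ x) Ω volume :=
  integrableOn_mul_test hu hφ.continuous hc hs fun _ hx => image_eq_zero_of_notMem_tsupport hx

theorem IsWeakPartialDeriv.add {n : ℕ} {Ω : Set (Rn n)} {j : Fin n} {u₁ u₂ v₁ v₂ : Rn n → ℝ}
    (h₁ : IsWeakPartialDeriv Ω j u₁ v₁) (h₂ : IsWeakPartialDeriv Ω j u₂ v₂) :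
    IsWeakPartialDeriv Ω j (fun x => u₁ x + u₂ x) (fun x => v₁ x + v₂ x) where
  locallyIntegrableOn := h₁.locallyIntegrableOn.add h₂.locallyIntegrableOn
  locallyIntegrableOn_deriv := h₁.locallyIntegrableOn_deriv.add h₂.locallyIntegrableOn_deriv
  integral_eq φ hφ hc hs := by
    simp only [add_mul]
    rw [integral_add (integrableOn_mul_fderiv h₁.1 hφ hc hs _)
        (integrableOn_mul_fderiv h₂.1 hφ hc hs _),
      integral_add (integrableOn_mul_self h₁.2 hφ hc hs)
        (integrableOn_mul_self h₂.2 hφ hc hs),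
      h₁.integral_eq φ hφ hc hs, h₂.integral_eq φ hφ hc hs, neg_add]

theorem IsWeakPartialDeriv.smul {n : ℕ} {Ω : Set (Rn n)} {j : Fin n} {u v : Rn n → ℝ}
    (h : IsWeakPartialDeriv Ω j u v) (a : ℝ) :
    IsWeakPartialDeriv Ω j (fun x => a * u x) (fun x => a * v x) where
  locallyIntegrableOn := h.locallyIntegrableOn.smul a
  locallyIntegrableOn_deriv := h.locallyIntegrableOn_deriv.smul a
  integral_eq φ hφ hc hs := by
    simp only [mul_assoc, integral_const_mul, h.integral_eq φ hφ hc hs, mul_neg]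

theorem isWeakGradient_zero {n : ℕ} (Ω : Set (Rn n)) :
    IsWeakGradient Ω (fun _ => (0 : ℝ)) (fun _ => (0 : Rn n)) :=
  ⟨locallyIntegrableOn_zero, fun _ => ⟨locallyIntegrableOn_zero, locallyIntegrableOn_zero,
    fun _ _ _ _ => by simp⟩⟩

theorem IsWeakGradient.add {n : ℕ} {Ω : Set (Rn n)} {u₁ u₂ : Rn n → ℝ} {v₁ v₂ : Rn n → Rn n}
    (h₁ : IsWeakGradient Ω u₁ v₁) (h₂ : IsWeakGradient Ω u₂ v₂) :
    IsWeakGradient Ω (fun x => u₁ x + u₂ x) (fun x => v₁ x + v₂ x) :=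
  ⟨h₁.1.add h₂.1, fun j => (h₁.2 j).add (h₂.2 j)⟩

theorem IsWeakGradient.smul {n : ℕ} {Ω : Set (Rn n)} {u : Rn n → ℝ} {v : Rn n → Rn n}
    (h : IsWeakGradient Ω u v) (a : ℝ) :
    IsWeakGradient Ω (fun x => a * u x) (fun x => a • v x) :=
  ⟨h.1.smul a, fun j => (h.2 j).smul a⟩

instance factOneLeOfReal (p : ℝ) [hp : Fact (1 ≤ p)] : Fact (1 ≤ ENNReal.ofReal p) :=
  ⟨by simpa using hp.out⟩

/-- The normed space `W^{1,p}(Ω; w dx)`. A function `u` with weak gradient `∇u` is recorded as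
the pair of its a.e. class and that of `∇u`, with the norm
`‖u‖_{1,p} = (∫_Ω |u|^p w dx + ∫_Ω |∇u|^p w dx)^{1/p}`
that `WithLp` puts on a product of two `L^p` spaces. -/
def W1p {n : ℕ} (p : ℝ) [Fact (1 ≤ p)] (Ω : Set (Rn n)) (w : Rn n → ℝ) :
    Submodule ℝ (WithLp (ENNReal.ofReal p)
      (Lp ℝ (ENNReal.ofReal p) ((weightMeasure w).restrict Ω) ×
        Lp (Rn n) (ENNReal.ofReal p) ((weightMeasure w).restrict Ω))) where
  carrier := {F | ∃ (u : Rn n → ℝ) (v : Rn n → Rn n), IsWeakGradient Ω u v ∧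
    F.fst =ᵐ[(weightMeasure w).restrict Ω] u ∧ F.snd =ᵐ[(weightMeasure w).restrict Ω] v}
  zero_mem' := ⟨_, _, isWeakGradient_zero Ω, Lp.coeFn_zero _ _ _, Lp.coeFn_zero _ _ _⟩
  add_mem' := by
    rintro F G ⟨u₁, v₁, h₁, hu₁, hv₁⟩ ⟨u₂, v₂, h₂, hu₂, hv₂⟩
    exact ⟨_, _, h₁.add h₂, (Lp.coeFn_add F.fst G.fst).trans (hu₁.add hu₂),
      (Lp.coeFn_add F.snd G.snd).trans (hv₁.add hv₂)⟩
  smul_mem' := by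
    rintro a F ⟨u, v, h, hu, hv⟩
    exact ⟨_, _, h.smul a, (Lp.coeFn_smul a F.fst).trans (hu.const_smul a),
      (Lp.coeFn_smul a F.snd).trans (hv.const_smul a)⟩

/-- The weight `|x|^γ`. -/
def powerWeight (n : ℕ) (γ : ℝ) : Rn n → ℝ := fun x => ‖x‖ ^ γ

/-- The function `|x|^{1-n}`. -/
def radialFun (n : ℕ) : Rn n → ℝ := fun x => ‖x‖ ^ (1 - (n : ℝ))

end WeightedSobolev

end

noncomputable section

namespace WeightedSobolev

/-! ### Integrals of powers of the norm -/

/-! The counterexamples rest on the singularity of |x|^{1-n}. Away from 0 its gradient has size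
(n-1)|x|^{-n}, which is not Lebesgue integrable near 0; hence no function agreeing with it a.e. near
0 is weakly differentiable across 0 (`not_isWeaklyDifferentiable_of_ae_eq_radialFun`). But |x|^{-n}
is in L^p(|x|^γ dx) near 0 as soon as γ > n(p-1), and a multiple of it dominates η(|x|²+ε)^{(1-n)/2}
and its gradient uniformly in ε. Dominated convergence as ε → 0 gives smooth approximations in norm
(`exists_smooth_approximation`). So η|x|^{1-n} belongs to H, is the missing limit of a Cauchy
sequence in W, and belongs to W off the origin but not across it.

For admissibility, Jensen's inequality reduces the Poincaré inequality to exponent 1. The difference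
u(x) - u(y) is at most the integral of the gradient along the segment, and the weight at x has to be
transferred to the running point z of the segment. After averaging over directions this costs only a
constant, provided |x| ≤ K|z| (`exists_setLIntegral_enorm_sub_le`). Segments passing too close to 0
violate this condition, so y cannot range over all of Q.

The remedy is a pair of subcubes B₁, B₂ of Q, of comparable size and transversal to each other as
seen from 0. If segments from x to both of them came close to 0, their endpoints would be nearly
collinear with 0; so each x in Q sees at least one of them along good segments
(`exists_subcubes_visible`). On the points that see Bᵢ, u is compared with its mean over Bᵢ. The two
means are compared through B₁, which sees both subcubes and carries a fixed proportion of the mass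
of 2Q (`exists_weightMeasure_cube_two_mul_le`, which also gives doubling). -/

theorem nontrivial_Rn {n : ℕ} (hn : n ≠ 0) : Nontrivial (Rn n) := by
  have : NeZero n := ⟨hn⟩
  infer_instance

theorem integrableOn_ball_norm_rpow_iff {n : ℕ} (hn : n ≠ 0) {a r : ℝ} (hr : 0 < r) :
    IntegrableOn (fun x : Rn n => ‖x‖ ^ a) (Metric.ball 0 r) volume ↔ -(n : ℝ) < a := by
  have := nontrivial_Rn hn
  rw [integrableOn_fun_norm_addHaar volume (f := fun y : ℝ => y ^ a)]
  have h : Set.EqOn (fun y : ℝ => y ^ (Module.finrank ℝ (Rn n) - 1) • y ^ a)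
      (fun y : ℝ => y ^ ((n : ℝ) - 1 + a)) (Set.Ioo 0 r) := by
    intro y hy
    have h1 : (1 : ℕ) ≤ n := Nat.one_le_iff_ne_zero.mpr hn
    simp only [finrank_euclideanSpace, Fintype.card_fin, smul_eq_mul]
    rw [Real.rpow_add hy.1, ← Real.rpow_natCast, Nat.cast_sub h1, Nat.cast_one]
  rw [integrableOn_congr_fun h measurableSet_Ioo, intervalIntegral.integrableOn_Ioo_rpow_iff hr]
  constructor <;> intro h <;> linarith

theorem measurable_norm_rpow {n : ℕ} (a : ℝ) : Measurable (fun x : Rn n => ‖x‖ ^ a) :=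
  measurable_norm.pow_const a

/-- The power weight as an extended nonnegative function. -/
def powerDensity (n : ℕ) (a : ℝ) : Rn n → ℝ≥0∞ := fun x => ENNReal.ofReal (‖x‖ ^ a)

theorem measurable_powerDensity (n : ℕ) (a : ℝ) : Measurable (powerDensity n a) :=
  (measurable_norm_rpow a).ennreal_ofReal

theorem weightMeasure_powerWeight_apply {n : ℕ} (a : ℝ) {s : Set (Rn n)} (hs : MeasurableSet s) :
    weightMeasure (powerWeight n a) s = ∫⁻ x in s, powerDensity n a x :=
  withDensity_apply _ hs

/-- No measurability of g is needed, because the density is measurable and finite. This matters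
since u is arbitrary outside its cube. -/
theorem setLIntegral_weightMeasure_powerWeight {n : ℕ} (a : ℝ) {s : Set (Rn n)}
    (hs : MeasurableSet s) (g : Rn n → ℝ≥0∞) :
    ∫⁻ x in s, g x ∂weightMeasure (powerWeight n a) =
      ∫⁻ x in s, powerDensity n a x * g x := by
  rw [weightMeasure, setLIntegral_withDensity_eq_setLIntegral_mul_non_measurable _ _ _ hs]
  · rfl
  · exact Filter.Eventually.of_forall fun x => ENNReal.ofReal_lt_top
  · exact measurable_powerDensity n a

theorem setLIntegral_ball_powerDensity_lt_top {n : ℕ} (hn : n ≠ 0) {a : ℝ} (ha : -(n : ℝ) < a)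
    (r : ℝ) : ∫⁻ x in Metric.ball (0 : Rn n) r, powerDensity n a x < ⊤ := by
  have h : IntegrableOn (fun x : Rn n => ‖x‖ ^ a) (Metric.ball 0 (max r 1)) volume :=
    (integrableOn_ball_norm_rpow_iff hn (by positivity)).mpr ha
  have h2 := (h.mono_set (Metric.ball_subset_ball (le_max_left r 1))).lintegral_lt_top
  exact h2

theorem lintegral_comp_sub_smul {n : ℕ} {f : Rn n → ℝ≥0∞} (hf : Measurable f) (z : Rn n) {t : ℝ}
    (ht : 0 < t) :
    ∫⁻ v, f (z - t • v) = ENNReal.ofReal ((t ^ n)⁻¹) * ∫⁻ x, f x := by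
  have h1 : ∫⁻ v, f (z - t • v) = ∫⁻ y, f (z - y) ∂(Measure.map (t • ·) volume) := by
    rw [lintegral_map (by fun_prop) (by fun_prop)]
  rw [h1, Measure.map_addHaar_smul _ ht.ne', lintegral_smul_measure,
    lintegral_sub_left_eq_self f z]
  simp [abs_of_pos ht]

/-- Homogeneity: dilation by r contributes r^n from Lebesgue measure and r^a from the weight. -/
theorem setLIntegral_ball_powerDensity {n : ℕ} (a : ℝ) {r : ℝ} (hr : 0 < r) :
    ∫⁻ x in Metric.ball (0 : Rn n) r, powerDensity n a x =
      ENNReal.ofReal (r ^ n * r ^ a) * ∫⁻ x in Metric.ball (0 : Rn n) 1, powerDensity n a x := by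
  have hm := (measurable_powerDensity n a).indicator (Metric.isOpen_ball (x := (0 : Rn n))
    (ε := r)).measurableSet
  have h := lintegral_comp_sub_smul hm 0 hr
  rw [← lintegral_indicator Metric.isOpen_ball.measurableSet,
    ← lintegral_indicator Metric.isOpen_ball.measurableSet]
  have h2 : ∀ v : Rn n, (Metric.ball (0 : Rn n) r).indicator (powerDensity n a) (0 - r • v) =
      ENNReal.ofReal (r ^ a) * (Metric.ball (0 : Rn n) 1).indicator (powerDensity n a) v := by
    intro v
    by_cases hv : ‖v‖ < 1
    · have h3 : r * ‖v‖ < r := by nlinarith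
      simp only [Set.indicator, mem_ball_zero_iff, zero_sub, norm_neg, norm_smul, Real.norm_eq_abs,
        abs_of_pos hr, h3, hv, if_true, powerDensity]
      rw [Real.mul_rpow hr.le (norm_nonneg _), ENNReal.ofReal_mul (by positivity)]
    · have h3 : ¬ r * ‖v‖ < r := by nlinarith
      simp [Set.indicator, norm_smul, abs_of_pos hr, h3, hv]
  simp only [h2] at h
  rw [lintegral_const_mul _ ((measurable_powerDensity n a).indicator
    Metric.isOpen_ball.measurableSet)] at h
  have hrn : 0 < r ^ n := by positivity
  rw [ENNReal.ofReal_mul hrn.le, mul_assoc, h, ← mul_assoc, ← ENNReal.ofReal_mul hrn.le,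
    mul_inv_cancel₀ hrn.ne', ENNReal.ofReal_one, one_mul]

/-- The exponent |a| covers both signs of a at once; h2 is used for the growing power and h1 for the
decaying one. -/
theorem rpow_le_rpow_abs_mul_rpow {K r s : ℝ} (a : ℝ) (hr : 0 < r) (hK : 1 ≤ K)
    (h1 : s ≤ K * r) (h2 : r ≤ K * s) : r ^ a ≤ K ^ |a| * s ^ a := by
  have hK0 : 0 < K := by linarith
  have hs : 0 < s := by
    by_contra h
    nlinarith
  have key : (r / s) ^ a ≤ K ^ |a| := by
    rcases le_total 0 a with ha | ha
    · rw [abs_of_nonneg ha]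
      exact Real.rpow_le_rpow (by positivity) ((div_le_iff₀ hs).mpr h2) ha
    · rw [abs_of_nonpos ha]
      have : (r / s) ^ a = (s / r) ^ (-a) := by
        rw [Real.rpow_neg (by positivity), ← Real.inv_rpow (by positivity), inv_div]
      rw [this]
      exact Real.rpow_le_rpow (by positivity) ((div_le_iff₀ hr).mpr h1) (by linarith)
  rwa [Real.div_rpow hr.le hs.le, div_le_iff₀ (by positivity)] at key

theorem powerDensity_le_of_comparable {n : ℕ} {K : ℝ} (a : ℝ) {x z : Rn n} (hx : x ≠ 0)
    (hK : 1 ≤ K) (h1 : ‖z‖ ≤ K * ‖x‖) (h2 : ‖x‖ ≤ K * ‖z‖) :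
    powerDensity n a x ≤ ENNReal.ofReal (K ^ |a|) * powerDensity n a z := by
  rw [powerDensity, powerDensity, ← ENNReal.ofReal_mul (by positivity)]
  exact ENNReal.ofReal_le_ofReal
    (rpow_le_rpow_abs_mul_rpow a (norm_pos_iff.mpr hx) hK h1 h2)

/-- A weighted volume bound for the points `x = z - t v` seen from `z`. -/
theorem exists_setLIntegral_powerDensity_sub_smul_le {n : ℕ} (hn : n ≠ 0) {a : ℝ}
    (ha : -(n : ℝ) < a) {K : ℝ} (hK : 1 ≤ K) :
    ∃ C : ℝ≥0, ∀ D : ℝ, 0 < D → ∀ z : Rn n, z ≠ 0 → ∀ t : ℝ, 0 < t →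
      ∫⁻ v in {v : Rn n | ‖v‖ ≤ D ∧ ‖z - t • v‖ ≤ K * ‖z‖}, powerDensity n a (z - t • v) ≤
        C * ENNReal.ofReal (D ^ n) * powerDensity n a z := by
  set I := ∫⁻ x in Metric.ball (0 : Rn n) 1, powerDensity n a x with hI
  have hIfin : I < ⊤ := setLIntegral_ball_powerDensity_lt_top hn ha 1
  set V := volume (Metric.ball (0 : Rn n) 1)
  have hVfin : V < ⊤ := measure_ball_lt_top
  set A := ENNReal.ofReal ((2 * K) ^ |a|) * V + ENNReal.ofReal ((1 / 2) ^ a) * I with hA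
  have hAfin : A ≠ ⊤ := by
    simp only [hA]
    finiteness
  refine ⟨A.toNNReal, fun D hD z hz t ht => ?_⟩
  rw [ENNReal.coe_toNNReal hAfin]
  have hz0 : 0 < ‖z‖ := norm_pos_iff.mpr hz
  -- On S1 the point z - tv has norm comparable to |z|, so the weight is comparable to its value at
  -- z. On S2 it is close to 0, where the weight may be singular and is integrated by scaling
  -- instead.
  set S1 : Set (Rn n) := {v | ‖v‖ ≤ D ∧ ‖z‖ / 2 ≤ ‖z - t • v‖ ∧ ‖z - t • v‖ ≤ K * ‖z‖}
  set S2 : Set (Rn n) := {v | ‖v‖ ≤ D ∧ ‖z - t • v‖ < ‖z‖ / 2}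
  have hS1 : MeasurableSet S1 := by
    have h1 : IsClosed {v : Rn n | ‖v‖ ≤ D} := isClosed_le (by fun_prop) (by fun_prop)
    have h2 : IsClosed {v : Rn n | ‖z‖ / 2 ≤ ‖z - t • v‖} :=
      isClosed_le (by fun_prop) (by fun_prop)
    have h3 : IsClosed {v : Rn n | ‖z - t • v‖ ≤ K * ‖z‖} :=
      isClosed_le (by fun_prop) (by fun_prop)
    exact (h1.inter (h2.inter h3)).measurableSet
  have hS2 : MeasurableSet S2 := by
    have h1 : MeasurableSet {v : Rn n | ‖v‖ ≤ D} := measurableSet_le (by fun_prop) (by fun_prop)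
    have h2 : MeasurableSet {v : Rn n | ‖z - t • v‖ < ‖z‖ / 2} :=
      measurableSet_lt (by fun_prop) (by fun_prop)
    exact h1.inter h2
  have hsub : {v : Rn n | ‖v‖ ≤ D ∧ ‖z - t • v‖ ≤ K * ‖z‖} ⊆ S1 ∪ S2 := by
    intro v hv
    by_cases h : ‖z‖ / 2 ≤ ‖z - t • v‖
    · exact Or.inl ⟨hv.1, h, hv.2⟩
    · exact Or.inr ⟨hv.1, not_le.mp h⟩
  have b1 : ∫⁻ v in S1, powerDensity n a (z - t • v) ≤
      ENNReal.ofReal ((2 * K) ^ |a|) * V * ENNReal.ofReal (D ^ n) * powerDensity n a z := by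
    calc ∫⁻ v in S1, powerDensity n a (z - t • v)
        ≤ ∫⁻ _ in S1, ENNReal.ofReal ((2 * K) ^ |a|) * powerDensity n a z := by
          refine setLIntegral_mono' hS1 fun v hv => ?_
          refine powerDensity_le_of_comparable a ?_ (by linarith) ?_ ?_
          · rw [← norm_pos_iff]
            linarith [hv.2.1]
          · nlinarith [hv.2.1]
          · nlinarith [hv.2.2]
      _ ≤ ENNReal.ofReal ((2 * K) ^ |a|) * powerDensity n a z * (ENNReal.ofReal (D ^ n) * V) := by
          rw [setLIntegral_const]
          gcongr
          calc volume S1 ≤ volume (Metric.closedBall (0 : Rn n) D) :=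
                measure_mono fun v hv => by simpa using hv.1
            _ = _ := by
                rw [Measure.addHaar_closedBall _ _ hD.le]
                simp [V]
      _ = _ := by ring
  have b2 : ∫⁻ v in S2, powerDensity n a (z - t • v) ≤
      ENNReal.ofReal ((1 / 2) ^ a) * I * ENNReal.ofReal (D ^ n) * powerDensity n a z := by
    -- S2 is nonempty only if tD ≥ |z|/2. In that case the Jacobian t^{-n} is absorbed, since
    -- (|z|/2)^n ≤ (tD)^n.
    by_cases hfar : 2 * (t * D) < ‖z‖
    · have : S2 = ∅ := by
        ext v
        simp only [S2, Set.mem_ofPred_eq, Set.mem_empty_iff_false, iff_false, not_and, not_lt]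
        intro hv
        have h1 : ‖z‖ - ‖t • v‖ ≤ ‖z - t • v‖ := norm_sub_norm_le _ _
        rw [norm_smul, Real.norm_eq_abs, abs_of_pos ht] at h1
        nlinarith
      simp [this]
    · push Not at hfar
      have hm := (measurable_powerDensity n a).indicator (Metric.isOpen_ball (x := (0 : Rn n))
        (ε := ‖z‖ / 2)).measurableSet
      calc ∫⁻ v in S2, powerDensity n a (z - t • v)
          = ∫⁻ v in S2, (Metric.ball (0 : Rn n) (‖z‖ / 2)).indicator (powerDensity n a)
              (z - t • v) := by
            refine setLIntegral_congr_fun hS2 fun v hv => ?_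
            · have : z - t • v ∈ Metric.ball (0 : Rn n) (‖z‖ / 2) := by simpa using hv.2
              simp [Set.indicator_of_mem this]
        _ ≤ ∫⁻ v, (Metric.ball (0 : Rn n) (‖z‖ / 2)).indicator (powerDensity n a)
              (z - t • v) := setLIntegral_le_lintegral _ _
        _ = ENNReal.ofReal ((t ^ n)⁻¹) * (ENNReal.ofReal ((‖z‖ / 2) ^ n * (‖z‖ / 2) ^ a) * I) := by
            rw [lintegral_comp_sub_smul hm z ht,
              lintegral_indicator Metric.isOpen_ball.measurableSet,
              setLIntegral_ball_powerDensity a (by positivity)]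
        _ ≤ ENNReal.ofReal ((1 / 2) ^ a * D ^ n * ‖z‖ ^ a) * I := by
            rw [← mul_assoc, ← ENNReal.ofReal_mul (by positivity)]
            refine mul_le_mul_left (ENNReal.ofReal_le_ofReal ?_) I
            have e : (‖z‖ / 2) ^ a = (1 / 2) ^ a * ‖z‖ ^ a := by
              rw [← Real.mul_rpow (by norm_num) hz0.le]
              ring_nf
            rw [e]
            have h1 : (‖z‖ / 2) ^ n ≤ t ^ n * D ^ n := by
              rw [← mul_pow]
              exact pow_le_pow_left₀ (by positivity) (by linarith) n
            have h2 : (t ^ n)⁻¹ * (‖z‖ / 2) ^ n ≤ D ^ n := by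
              rw [inv_mul_le_iff₀ (by positivity)]
              exact h1
            calc (t ^ n)⁻¹ * ((‖z‖ / 2) ^ n * ((1 / 2) ^ a * ‖z‖ ^ a))
                = ((t ^ n)⁻¹ * (‖z‖ / 2) ^ n) * ((1 / 2) ^ a * ‖z‖ ^ a) := by ring
              _ ≤ D ^ n * ((1 / 2) ^ a * ‖z‖ ^ a) := by gcongr
              _ = _ := by ring
        _ = _ := by
            rw [ENNReal.ofReal_mul (by positivity), ENNReal.ofReal_mul (by positivity),
              powerDensity]
            ring
  calc ∫⁻ v in {v : Rn n | ‖v‖ ≤ D ∧ ‖z - t • v‖ ≤ K * ‖z‖}, powerDensity n a (z - t • v)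
      ≤ ∫⁻ v in S1 ∪ S2, powerDensity n a (z - t • v) := lintegral_mono_set hsub
    _ ≤ _ := lintegral_union_le _ _ _
    _ ≤ _ := add_le_add b1 b2
    _ = _ := by rw [hA]; ring

/-! ### A weighted potential estimate along segments -/

/-- The indicator lets the running point of a segment range over the whole space in Tonelli
arguments while only Q is counted. -/
theorem measurable_indicator_enorm_fderiv {n : ℕ} {Q : Set (Rn n)} (hQ : IsOpen Q) {u : Rn n → ℝ}
    (hu : ContDiffOn ℝ ∞ u Q) : Measurable (Q.indicator fun x => ‖fderiv ℝ u x‖ₑ) := by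
  have h : ContinuousOn (fun x => ‖fderiv ℝ u x‖ₑ) Q :=
    (hu.continuousOn_fderiv_of_isOpen hQ (by simp)).enorm
  classical
  rw [← Set.piecewise_eq_indicator]
  exact h.measurable_piecewise continuousOn_const hQ.measurableSet

theorem enorm_sub_le_lintegral_fderiv {n : ℕ} {Q : Set (Rn n)} (hQ : IsOpen Q) (hc : Convex ℝ Q)
    {u : Rn n → ℝ} (hu : ContDiffOn ℝ ∞ u Q) {D : ℝ} {x y : Rn n} (hx : x ∈ Q) (hy : y ∈ Q)
    (hD : ‖y - x‖ ≤ D) :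
    ‖u x - u y‖ₑ ≤ ENNReal.ofReal D *
      ∫⁻ t in Set.Ioc (0 : ℝ) 1, Q.indicator (fun x => ‖fderiv ℝ u x‖ₑ) (x + t • (y - x)) := by
  have hmem : ∀ t ∈ Set.Icc (0 : ℝ) 1, x + t • (y - x) ∈ Q := fun t ht =>
    hc.add_smul_sub_mem hx hy ht
  have hd : ∀ t ∈ Set.uIcc (0 : ℝ) 1,
      HasDerivAt (fun t : ℝ => u (x + t • (y - x))) (fderiv ℝ u (x + t • (y - x)) (y - x)) t := by
    intro t ht
    rw [Set.uIcc_of_le zero_le_one] at ht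
    have h1 : DifferentiableAt ℝ u (x + t • (y - x)) :=
      (hu.contDiffAt (hQ.mem_nhds (hmem t ht))).differentiableAt (by simp)
    have h2 : HasDerivAt (fun t : ℝ => x + t • (y - x)) (y - x) t := by
      simpa using ((hasDerivAt_id t).smul_const (y - x)).const_add x
    exact h1.hasFDerivAt.comp_hasDerivAt t h2
  have hcont : ContinuousOn (fun t : ℝ => fderiv ℝ u (x + t • (y - x)) (y - x))
      (Set.uIcc (0 : ℝ) 1) := by
    rw [Set.uIcc_of_le zero_le_one]
    have h1 : ContinuousOn (fun t : ℝ => fderiv ℝ u (x + t • (y - x))) (Set.Icc 0 1) :=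
      (hu.continuousOn_fderiv_of_isOpen hQ (by simp)).comp (by fun_prop) hmem
    exact h1.clm_apply continuousOn_const
  have key := intervalIntegral.integral_eq_sub_of_hasDerivAt hd hcont.intervalIntegrable
  simp only [one_smul, add_sub_cancel, zero_smul, add_zero] at key
  rw [intervalIntegral.integral_of_le zero_le_one] at key
  rw [enorm_sub_rev, ← key, ← lintegral_const_mul' _ _ ENNReal.ofReal_ne_top]
  refine (enorm_integral_le_lintegral_enorm _).trans ?_
  refine setLIntegral_mono' measurableSet_Ioc fun t ht => ?_
  rw [Set.indicator_of_mem (hmem t ⟨ht.1.le, ht.2⟩), mul_comm]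
  refine (ContinuousLinearMap.le_opENorm _ _).trans ?_
  gcongr
  rw [← ofReal_norm]
  exact ENNReal.ofReal_le_ofReal hD

/-- Substitute v = y - x, then z = x + tv. For fixed z what remains is the integral of the weight at
z - tv over |v| ≤ D, |z - tv| ≤ K|z|, bounded by the previous volume estimate. The constant does not
depend on t, so integrating over t in (0,1] later is harmless. -/
theorem exists_setLIntegral_comp_segment_le {n : ℕ} (hn : n ≠ 0) {a : ℝ} (ha : -(n : ℝ) < a)
    {K : ℝ} (hK : 1 ≤ K) :
    ∃ C : ℝ≥0, ∀ (D : ℝ), 0 < D → ∀ (E B : Set (Rn n)), MeasurableSet E → MeasurableSet B →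
      (∀ x ∈ E, ∀ y ∈ B, ‖y - x‖ ≤ D) →
      ∀ t : ℝ, 0 < t → (∀ x ∈ E, ∀ y ∈ B, ‖x‖ ≤ K * ‖x + t • (y - x)‖) →
      ∀ g : Rn n → ℝ≥0∞, Measurable g →
      ∫⁻ x in E, powerDensity n a x * ∫⁻ y in B, g (x + t • (y - x)) ≤
        C * ENNReal.ofReal (D ^ n) * ∫⁻ z, powerDensity n a z * g z := by
  obtain ⟨C, hC⟩ := exists_setLIntegral_powerDensity_sub_smul_le hn ha hK
  refine ⟨C, fun D hD E B hE hB hED t ht hEB g hg => ?_⟩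
  have := nontrivial_Rn hn
  set W := powerDensity n a with hW
  have hWm : Measurable W := measurable_powerDensity n a
  -- F is the weight on E, together with the constraint x + v ∈ B, in the new variables.
  set F : Rn n → Rn n → ℝ≥0∞ := fun x v => E.indicator W x * B.indicator 1 (x + v) with hF
  have hEW : Measurable (E.indicator W) := hWm.indicator hE
  have hB1 : Measurable (B.indicator (1 : Rn n → ℝ≥0∞)) := measurable_one.indicator hB
  have e1 : ∫⁻ x in E, W x * ∫⁻ y in B, g (x + t • (y - x)) =
      ∫⁻ x, ∫⁻ v, F x v * g (x + t • v) := by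
    rw [← lintegral_indicator hE]
    refine lintegral_congr fun x => ?_
    have e2 : ∫⁻ y in B, g (x + t • (y - x)) = ∫⁻ v, B.indicator 1 (x + v) * g (x + t • v) := by
      rw [← lintegral_indicator hB, ← lintegral_add_left_eq_self _ x]
      refine lintegral_congr fun v => ?_
      by_cases h : x + v ∈ B <;> simp [h]
    simp only [hF, mul_assoc]
    rw [lintegral_const_mul _ (by fun_prop), ← e2]
    by_cases h : x ∈ E <;> simp [h]
  have e3 : ∫⁻ x, ∫⁻ v, F x v * g (x + t • v) = ∫⁻ z, g z * ∫⁻ v, F (z - t • v) v := by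
    rw [lintegral_lintegral_swap (by fun_prop)]
    have : ∀ v, ∫⁻ x, F x v * g (x + t • v) = ∫⁻ z, g z * F (z - t • v) v := by
      intro v
      rw [← lintegral_sub_right_eq_self _ (t • v)]
      refine lintegral_congr fun z => ?_
      simp [mul_comm]
    simp only [this]
    rw [lintegral_lintegral_swap (by fun_prop)]
    refine lintegral_congr fun z => ?_
    rw [lintegral_const_mul _ (by fun_prop)]
  rw [e1, e3, ← lintegral_const_mul _ (by fun_prop)]
  refine lintegral_mono_ae ?_
  filter_upwards [Measure.ae_ne volume (0 : Rn n)] with z hz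
  have b : ∫⁻ v, F (z - t • v) v ≤ C * ENNReal.ofReal (D ^ n) * W z := by
    refine le_trans ?_ (hC D hD z hz t ht)
    have hm : MeasurableSet {v : Rn n | ‖v‖ ≤ D ∧ ‖z - t • v‖ ≤ K * ‖z‖} := by
      have h1 : MeasurableSet {v : Rn n | ‖v‖ ≤ D} := measurableSet_le (by fun_prop) (by fun_prop)
      have h2 : MeasurableSet {v : Rn n | ‖z - t • v‖ ≤ K * ‖z‖} :=
        measurableSet_le (by fun_prop) (by fun_prop)
      exact h1.inter h2
    rw [← lintegral_indicator hm]
    refine lintegral_mono fun v => ?_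
    by_cases h1 : z - t • v ∈ E
    · by_cases h2 : z - t • v + v ∈ B
      · have h3 := hED _ h1 _ h2
        have h4 := hEB _ h1 _ h2
        rw [add_sub_cancel_left] at h3 h4
        rw [sub_add_cancel] at h4
        rw [Set.indicator_of_mem (show v ∈ {v : Rn n | ‖v‖ ≤ D ∧ ‖z - t • v‖ ≤ K * ‖z‖} from
          ⟨h3, h4⟩)]
        simp [hF, h1, h2]
      · simp [hF, h2]
    · simp [hF, h1]
  calc g z * ∫⁻ v, F (z - t • v) v ≤ g z * (C * ENNReal.ofReal (D ^ n) * W z) := by gcongr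
    _ = _ := by ring

/-- Differences of `u` between `E` and `B` are controlled by the gradient if the segments from `E`
to `B` do not come much closer to the origin than their starting points. -/
theorem exists_setLIntegral_enorm_sub_le {n : ℕ} (hn : n ≠ 0) {a : ℝ} (ha : -(n : ℝ) < a)
    {K : ℝ} (hK : 1 ≤ K) :
    ∃ C : ℝ≥0, ∀ (D : ℝ), 0 < D → ∀ (Q E B : Set (Rn n)), IsOpen Q → Convex ℝ Q →
      MeasurableSet E → MeasurableSet B → E ⊆ Q → B ⊆ Q →
      (∀ x ∈ Q, ∀ y ∈ Q, ‖y - x‖ ≤ D) →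
      (∀ x ∈ E, ∀ y ∈ B, ∀ t ∈ Set.Icc (0 : ℝ) 1, ‖x‖ ≤ K * ‖x + t • (y - x)‖) →
      ∀ u : Rn n → ℝ, ContDiffOn ℝ ∞ u Q →
      ∫⁻ x in E, powerDensity n a x * ∫⁻ y in B, ‖u x - u y‖ₑ ≤
        C * ENNReal.ofReal (D ^ (n + 1)) * ∫⁻ z in Q, powerDensity n a z * ‖fderiv ℝ u z‖ₑ := by
  obtain ⟨C, hC⟩ := exists_setLIntegral_comp_segment_le hn ha hK
  refine ⟨C, fun D hD Q E B hQ hc hE hB hEQ hBQ hQD hEB u hu => ?_⟩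
  set G := Q.indicator fun x => ‖fderiv ℝ u x‖ₑ with hG
  have hGm : Measurable G := measurable_indicator_enorm_fderiv hQ hu
  set W := powerDensity n a with hW
  have hWm : Measurable W := measurable_powerDensity n a
  calc ∫⁻ x in E, W x * ∫⁻ y in B, ‖u x - u y‖ₑ
      ≤ ∫⁻ x in E, W x * ∫⁻ y in B, ENNReal.ofReal D *
          ∫⁻ t in Set.Ioc (0 : ℝ) 1, G (x + t • (y - x)) := by
        refine setLIntegral_mono' hE fun x hx => ?_
        gcongr 1
        refine setLIntegral_mono' hB fun y hy => ?_
        exact enorm_sub_le_lintegral_fderiv hQ hc hu (hEQ hx) (hBQ hy)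
          (hQD _ (hEQ hx) _ (hBQ hy))
    _ = ENNReal.ofReal D * ∫⁻ x in E, ∫⁻ t in Set.Ioc (0 : ℝ) 1,
          W x * ∫⁻ y in B, G (x + t • (y - x)) := by
        rw [← lintegral_const_mul' _ _ ENNReal.ofReal_ne_top]
        refine lintegral_congr fun x => ?_
        rw [lintegral_const_mul' _ _ ENNReal.ofReal_ne_top,
          lintegral_lintegral_swap (by fun_prop), lintegral_const_mul _ (by fun_prop)]
        ring
    _ = ENNReal.ofReal D * ∫⁻ t in Set.Ioc (0 : ℝ) 1, ∫⁻ x in E,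
          W x * ∫⁻ y in B, G (x + t • (y - x)) := by
        rw [lintegral_lintegral_swap (by fun_prop)]
    _ ≤ ENNReal.ofReal D * ∫⁻ t in Set.Ioc (0 : ℝ) 1,
          C * ENNReal.ofReal (D ^ n) * ∫⁻ z, W z * G z := by
        gcongr 1
        refine setLIntegral_mono' measurableSet_Ioc fun t ht => ?_
        exact hC D hD E B hE hB (fun x hx y hy => hQD _ (hEQ hx) _ (hBQ hy)) t ht.1
          (fun x hx y hy => hEB x hx y hy t ⟨ht.1.le, ht.2⟩) G hGm
    _ = C * ENNReal.ofReal (D ^ (n + 1)) * ∫⁻ z, W z * G z := by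
        rw [setLIntegral_const, Real.volume_Ioc, sub_zero, ENNReal.ofReal_one, mul_one, pow_succ,
          ENNReal.ofReal_mul (by positivity)]
        ring
    _ = _ := by
        rw [← lintegral_indicator hQ.measurableSet]
        congr 2
        ext z
        by_cases h : z ∈ Q <;> simp [hG, h]

/-! ### Geometry of cubes -/

theorem isOpen_cube {n : ℕ} (c : Rn n) (l : ℝ) : IsOpen (cube c l) := by
  have : cube c l = ⋂ i, {x : Rn n | |x i - c i| < l / 2} := by
    ext x
    simp [cube]
  rw [this]
  exact isOpen_iInter_of_finite fun i => isOpen_lt (by fun_prop) (by fun_prop)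

theorem convex_cube {n : ℕ} (c : Rn n) (l : ℝ) : Convex ℝ (cube c l) := by
  intro x hx y hy a b ha hb hab i
  have h1 := abs_lt.mp (hx i)
  have h2 := abs_lt.mp (hy i)
  have e : (a • x + b • y) i - c i = a * (x i - c i) + b * (y i - c i) := by
    simp only [PiLp.add_apply, PiLp.smul_apply, smul_eq_mul]
    linear_combination c i * hab
  have e2 : l / 2 = a * (l / 2) + b * (l / 2) := by linear_combination -(l / 2) * hab
  rw [e]
  rcases ha.eq_or_lt with rfl | ha'
  · have : b = 1 := by linarith
    subst this
    simpa using hy i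
  · rw [abs_lt]
    constructor <;> nlinarith

theorem norm_le_sqrt_mul_of_forall_abs_le {n : ℕ} {x : Rn n} {r : ℝ} (hr : 0 ≤ r)
    (h : ∀ i, |x i| ≤ r) : ‖x‖ ≤ √n * r := by
  rw [EuclideanSpace.norm_eq]
  have h1 : ∑ i, ‖x i‖ ^ 2 ≤ n * r ^ 2 := by
    calc ∑ i, ‖x i‖ ^ 2 ≤ ∑ _i : Fin n, r ^ 2 :=
          Finset.sum_le_sum fun i _ => pow_le_pow_left₀ (norm_nonneg _) (h i) 2
      _ = n * r ^ 2 := by simp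
  calc √(∑ i, ‖x i‖ ^ 2) ≤ √(n * r ^ 2) := Real.sqrt_le_sqrt h1
    _ = √n * r := by rw [Real.sqrt_mul (by positivity), Real.sqrt_sq hr]

theorem norm_sub_le_of_mem_cube {n : ℕ} {c x y : Rn n} {l : ℝ} (hl : 0 < l) (hx : x ∈ cube c l)
    (hy : y ∈ cube c l) : ‖y - x‖ ≤ √n * l := by
  refine norm_le_sqrt_mul_of_forall_abs_le hl.le fun i => ?_
  have h1 := abs_lt.mp (hx i)
  have h2 := abs_lt.mp (hy i)
  rw [PiLp.sub_apply, abs_le]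
  constructor <;> linarith

theorem norm_sub_center_le {n : ℕ} {c x : Rn n} {l : ℝ} (hl : 0 < l) (hx : x ∈ cube c l) :
    ‖x - c‖ ≤ √n * (l / 2) :=
  norm_le_sqrt_mul_of_forall_abs_le (by positivity) fun i => (hx i).le

theorem isBounded_cube {n : ℕ} (c : Rn n) {l : ℝ} (hl : 0 < l) : Bornology.IsBounded (cube c l) :=
  (Metric.isBounded_closedBall (x := c) (r := √n * (l / 2))).subset fun x hx => by
    rw [mem_closedBall_iff_norm]
    exact norm_sub_center_le hl hx

/-- The points c ± (l/4)e₀ of the cube are already at distance l/2. -/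
theorem le_two_mul_diam_cube {n : ℕ} (hn : n ≠ 0) (c : Rn n) {l : ℝ} (hl : 0 < l) :
    l ≤ 2 * Metric.diam (cube c l) := by
  have : NeZero n := ⟨hn⟩
  have hm : ∀ r : ℝ, |r| < l / 2 → c + EuclideanSpace.single (0 : Fin n) r ∈ cube c l := by
    intro r hr i
    by_cases h : i = 0
    · subst h
      simpa using hr
    · simp [h]
      positivity
  have h1 := hm (l / 4) (by rw [abs_lt]; constructor <;> linarith)
  have h2 := hm (-(l / 4)) (by rw [abs_lt]; constructor <;> linarith)
  have h3 := Metric.dist_le_diam_of_mem (isBounded_cube c hl) h1 h2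
  rw [dist_add_left, PiLp.dist_single_same, Real.dist_eq, abs_of_pos (by linarith)] at h3
  linarith

theorem cube_subset_cube {n : ℕ} {b c : Rn n} {l m r : ℝ} (h : ∀ i, |b i - c i| ≤ r)
    (hr : m / 2 + r ≤ l / 2) : cube b m ⊆ cube c l := by
  intro x hx i
  calc |x i - c i| = |(x i - b i) + (b i - c i)| := by ring_nf
    _ ≤ |x i - b i| + |b i - c i| := abs_add_le _ _
    _ < m / 2 + r := add_lt_add_of_lt_of_le (hx i) (h i)
    _ ≤ l / 2 := hr

theorem volume_cube {n : ℕ} (c : Rn n) {l : ℝ} (hl : 0 < l) :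
    volume (cube c l) = ENNReal.ofReal (l ^ n) := by
  have e : cube c l = (MeasurableEquiv.toLp 2 (Fin n → ℝ)).symm ⁻¹'
      (Set.univ.pi fun i => Metric.ball (c i) (l / 2)) := by
    ext x
    simp [cube, Set.mem_pi, Real.dist_eq]
  rw [e, (EuclideanSpace.volume_preserving_symm_measurableEquiv_toLp
    (Fin n)).measure_preimage_equiv, volume_pi_pi]
  simp only [Real.volume_ball, mul_div_cancel₀ l (two_ne_zero), Finset.prod_const,
    Finset.card_univ, Fintype.card_fin]
  rw [ENNReal.ofReal_pow hl.le]

/-- Two subcubes of a cube, in a common half-space away from the origin, no point of the first being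
nearly collinear with the origin and a point of the second. -/
theorem exists_transversal_subcubes {n : ℕ} (hn : 2 ≤ n) (c : Rn n) {l : ℝ} (hl : 0 < l) :
    ∃ (b₁ b₂ : Rn n) (i j : Fin n) (σ : ℝ),
      (∀ k, |b₁ k - c k| ≤ 3 * l / 8) ∧ (∀ k, |b₂ k - c k| ≤ 3 * l / 8) ∧ |σ| = 1 ∧
      (∀ y ∈ cube b₁ (l / 8) ∪ cube b₂ (l / 8), l / 16 ≤ σ * y j) ∧
      (∀ y₁ ∈ cube b₁ (l / 8), ∀ y₂ ∈ cube b₂ (l / 8),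
        l ^ 2 / 64 ≤ |y₁ i * y₂ j - y₁ j * y₂ i|) := by
  set i : Fin n := ⟨0, by omega⟩
  set j : Fin n := ⟨1, by omega⟩
  have hij : j ≠ i := by simp [i, j]
  -- The signs s and σ reflect two coordinate axes so that the centre has nonnegative coordinates
  -- there.
  have hsign : ∀ r : ℝ, ∃ s : ℝ, |s| = 1 ∧ s * s = 1 ∧ s * r = |r| := by
    intro r
    rcases le_total 0 r with h | h
    · exact ⟨1, by simp, by simp, by simp [abs_of_nonneg h]⟩
    · exact ⟨-1, by simp, by simp, by simp [abs_of_nonpos h]⟩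
  obtain ⟨s, hs1, hs2, hs3⟩ := hsign (c i)
  obtain ⟨σ, hσ1, hσ2, hσ3⟩ := hsign (c j)
  -- The centre is shifted by αl and βl away from the coordinate hyperplanes. With shifts (1/8, 3/8)
  -- and (3/8, 1/8) the slopes of the two subcubes are separated, and cubes of side l/8 still fit in
  -- Q.
  let b : ℝ → ℝ → Rn n := fun α β => WithLp.toLp 2 fun k =>
    c k + if k = i then s * (α * l) else if k = j then σ * (β * l) else 0
  have hb : ∀ α β : ℝ, |α| ≤ 3 / 8 → |β| ≤ 3 / 8 → ∀ k, |b α β k - c k| ≤ 3 * l / 8 := by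
    intro α β hα hβ k
    simp only [b, add_sub_cancel_left]
    split_ifs
    · rw [abs_mul, hs1, abs_mul, abs_of_pos hl]
      nlinarith
    · rw [abs_mul, hσ1, abs_mul, abs_of_pos hl]
      nlinarith
    · rw [abs_zero]
      positivity
  have hy : ∀ α β : ℝ, ∀ y ∈ cube (b α β) (l / 8),
      |s * y i - |c i| - α * l| < l / 16 ∧ |σ * y j - |c j| - β * l| < l / 16 := by
    intro α β y hy
    have h1 := hy i
    have h2 := hy j
    simp only [b, if_true, hij, if_false] at h1 h2
    constructor
    · rw [← hs3]
      have : s * y i - s * c i - α * l = s * (y i - (c i + s * (α * l))) := by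
        linear_combination (α * l) * hs2
      rw [this, abs_mul, hs1]
      linarith
    · rw [← hσ3]
      have : σ * y j - σ * c j - β * l = σ * (y j - (c j + σ * (β * l))) := by
        linear_combination (β * l) * hσ2
      rw [this, abs_mul, hσ1]
      linarith
  refine ⟨b (1 / 8) (3 / 8), b (3 / 8) (1 / 8), i, j, σ, hb _ _ ?_ ?_, hb _ _ ?_ ?_, hσ1, ?_, ?_⟩
  · norm_num [abs_of_pos]
  · norm_num [abs_of_pos]
  · norm_num [abs_of_pos]
  · norm_num [abs_of_pos]
  · have hcj := abs_nonneg (c j)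
    rintro y (h | h)
    · have := (abs_lt.mp (hy _ _ y h).2).1
      linarith
    · have := (abs_lt.mp (hy _ _ y h).2).1
      linarith
  · intro y₁ h₁ y₂ h₂
    obtain ⟨p1, p2⟩ := hy _ _ y₁ h₁
    obtain ⟨q1, q2⟩ := hy _ _ y₂ h₂
    rw [abs_lt] at p1 p2 q1 q2
    have hcj := abs_nonneg (c j)
    have hci := abs_nonneg (c i)
    have e : |y₁ i * y₂ j - y₁ j * y₂ i| =
        |(s * y₂ i) * (σ * y₁ j) - (s * y₁ i) * (σ * y₂ j)| := by
      have : (s * y₂ i) * (σ * y₁ j) - (s * y₁ i) * (σ * y₂ j) =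
        -(s * σ) * (y₁ i * y₂ j - y₁ j * y₂ i) := by ring
      rw [this, abs_mul, abs_neg, abs_mul, hs1, hσ1, one_mul, one_mul]
    rw [e]
    refine le_trans ?_ (le_abs_self _)
    set A₁ := s * y₁ i
    set A₂ := s * y₂ i
    set B₁ := σ * y₁ j
    set B₂ := σ * y₂ j
    have h1 : l / 8 ≤ A₂ - A₁ := by linarith
    have h2 : l / 8 ≤ B₁ := by linarith
    have h3 : 0 ≤ B₁ - B₂ := by linarith
    have h4 : 0 ≤ A₁ := by linarith
    have h5 : l / 8 * (l / 8) ≤ (A₂ - A₁) * B₁ := by gcongr; linarith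
    -- A₂B₁ - A₁B₂ = (A₂ - A₁)B₁ + A₁(B₁ - B₂), where the first term is at least l²/64 and the
    -- second is nonnegative.
    nlinarith [mul_nonneg h4 h3]

/-! ### Visibility of subcubes along segments avoiding the origin -/

theorem abs_wedge_le {n : ℕ} (i j : Fin n) (x y : Rn n) :
    |x i * y j - x j * y i| ≤ 2 * (‖x‖ * ‖y‖) := by
  have h : ∀ (x : Rn n) k, |x k| ≤ ‖x‖ := fun x k => PiLp.norm_apply_le x k
  calc |x i * y j - x j * y i| ≤ |x i * y j| + |x j * y i| := abs_sub _ _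
    _ ≤ ‖x‖ * ‖y‖ + ‖x‖ * ‖y‖ := by
        rw [abs_mul, abs_mul]
        gcongr <;> apply h
    _ = _ := by ring

/-- If both segments from `x` to `y₁` and to `y₂` pass close to the origin relative to `‖x‖`, then
`y₁` and `y₂` are nearly collinear. -/
theorem norm_le_of_wedge {n : ℕ} {i j : Fin n} {x y₁ y₂ : Rn n} {D K : ℝ} {t₁ t₂ : ℝ}
    (hK : 2 ≤ K) (h1 : ‖y₁ - x‖ ≤ D) (h2 : ‖y₂ - x‖ ≤ D)
    (ht₁ : t₁ ∈ Set.Icc (0 : ℝ) 1) (ht₂ : t₂ ∈ Set.Icc (0 : ℝ) 1)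
    (hw₀ : 24 * D ^ 2 < K * |y₁ i * y₂ j - y₁ j * y₂ i|) :
    ‖x‖ ≤ K * ‖x + t₁ • (y₁ - x)‖ ∨ ‖x‖ ≤ K * ‖x + t₂ • (y₂ - x)‖ := by
  by_contra! hcon
  obtain ⟨hc1, hc2⟩ := hcon
  set e₁ := x + t₁ • (y₁ - x) with he₁
  set e₂ := x + t₂ • (y₂ - x) with he₂
  -- A segment that comes within |x|/K ≤ |x|/2 of the origin has travelled at least |x|/2.
  have hlow : ∀ (t : ℝ) (y : Rn n), 0 ≤ t → ‖y - x‖ ≤ D → K * ‖x + t • (y - x)‖ < ‖x‖ →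
      ‖x‖ ≤ 2 * (t * D) := by
    intro t y ht hy h
    have h3 : ‖x‖ - ‖x + t • (y - x)‖ ≤ ‖t • (y - x)‖ := by
      have := norm_sub_norm_le x (x + t • (y - x))
      rwa [sub_add_cancel_left, norm_neg] at this
    rw [norm_smul, Real.norm_eq_abs, abs_of_nonneg ht] at h3
    nlinarith [norm_nonneg (x + t • (y - x)), norm_nonneg x,
      mul_le_mul_of_nonneg_left hy ht]
  have l1 := hlow t₁ y₁ ht₁.1 h1 hc1
  have l2 := hlow t₂ y₂ ht₂.1 h2 hc2
  set φ : Rn n → Rn n → ℝ := fun x y => x i * y j - x j * y i with hφdef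
  have hx0 : 0 < ‖x‖ := lt_of_le_of_lt (by positivity) hc1
  -- Expand the wedge of tᵢyᵢ = eᵢ - (1 - tᵢ)x, using x ∧ x = 0. Every remaining term contains a
  -- small factor e₁ or e₂.
  have key : t₁ * t₂ * φ y₁ y₂ = φ e₁ e₂ - (1 - t₂) * φ e₁ x - (1 - t₁) * φ x e₂ := by
    simp only [hφdef, he₁, he₂, PiLp.add_apply, PiLp.smul_apply, PiLp.sub_apply, smul_eq_mul]
    ring
  have b1 := abs_wedge_le i j e₁ e₂
  have b2 := abs_wedge_le i j e₁ x
  have b3 := abs_wedge_le i j x e₂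
  have u1 : |t₁ * t₂ * φ y₁ y₂| ≤ 2 * (‖e₁‖ * ‖e₂‖) + 2 * (‖e₁‖ * ‖x‖) + 2 * (‖x‖ * ‖e₂‖) := by
    rw [key]
    have a1 : |(1 - t₂) * φ e₁ x| ≤ 2 * (‖e₁‖ * ‖x‖) := by
      rw [abs_mul, abs_of_nonneg (by linarith [ht₂.2])]
      nlinarith [abs_nonneg (φ e₁ x), ht₂.1]
    have a2 : |(1 - t₁) * φ x e₂| ≤ 2 * (‖x‖ * ‖e₂‖) := by
      rw [abs_mul, abs_of_nonneg (by linarith [ht₁.2])]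
      nlinarith [abs_nonneg (φ x e₂), ht₁.1]
    calc _ ≤ |φ e₁ e₂ - (1 - t₂) * φ e₁ x| + |(1 - t₁) * φ x e₂| := abs_sub _ _
      _ ≤ |φ e₁ e₂| + |(1 - t₂) * φ e₁ x| + |(1 - t₁) * φ x e₂| := by gcongr; exact abs_sub _ _
      _ ≤ _ := by gcongr
  have u2 : K * |t₁ * t₂ * φ y₁ y₂| ≤ 6 * ‖x‖ ^ 2 := by
    have hK0 : 0 < K := by linarith
    have n1 := norm_nonneg e₁
    have n2 := norm_nonneg e₂
    have f1 : ‖e₁‖ ≤ ‖x‖ := by nlinarith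
    have g1 : K * (‖e₁‖ * ‖e₂‖) ≤ ‖x‖ * ‖x‖ := by
      calc K * (‖e₁‖ * ‖e₂‖) = ‖e₁‖ * (K * ‖e₂‖) := by ring
        _ ≤ ‖x‖ * ‖x‖ := by gcongr
    have g2 : K * (‖e₁‖ * ‖x‖) ≤ ‖x‖ * ‖x‖ := by
      rw [← mul_assoc]
      gcongr
    have g3 : K * (‖x‖ * ‖e₂‖) ≤ ‖x‖ * ‖x‖ := by
      calc K * (‖x‖ * ‖e₂‖) = ‖x‖ * (K * ‖e₂‖) := by ring
        _ ≤ ‖x‖ * ‖x‖ := by gcongr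
    calc K * |t₁ * t₂ * φ y₁ y₂|
        ≤ K * (2 * (‖e₁‖ * ‖e₂‖) + 2 * (‖e₁‖ * ‖x‖) + 2 * (‖x‖ * ‖e₂‖)) := by gcongr
      _ ≤ 6 * ‖x‖ ^ 2 := by nlinarith
  have u3 : ‖x‖ ^ 2 ≤ 4 * (t₁ * t₂) * D ^ 2 := by
    calc ‖x‖ ^ 2 = ‖x‖ * ‖x‖ := by ring
      _ ≤ (2 * (t₁ * D)) * (2 * (t₂ * D)) := mul_le_mul l1 l2 hx0.le (hx0.le.trans l1)
      _ = _ := by ring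
  rw [abs_mul, abs_of_nonneg (mul_nonneg ht₁.1 ht₂.1)] at u2
  have htt : 0 < t₁ * t₂ := by
    rcases (mul_nonneg ht₁.1 ht₂.1).eq_or_lt with h | h
    · rw [← h] at u3
      nlinarith
    · exact h
  -- The upper bound 6|x|² and |x|² ≤ 4t₁t₂D² combine, and the factor t₁t₂, possibly tiny, cancels.
  have : t₁ * t₂ * (K * |φ y₁ y₂|) ≤ t₁ * t₂ * (24 * D ^ 2) := by nlinarith
  exact absurd (le_of_mul_le_mul_left this htt) (not_le.mpr hw₀)

theorem norm_le_two_mul_norm_add_smul {n : ℕ} {x y : Rn n} {D t : ℝ} (hxy : ‖y - x‖ ≤ D)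
    (ht : t ∈ Set.Icc (0 : ℝ) 1) (hx : 2 * D ≤ ‖x‖) : ‖x‖ ≤ 2 * ‖x + t • (y - x)‖ := by
  have h1 := norm_sub_norm_le x (x + t • (y - x))
  rw [sub_add_cancel_left, norm_neg, norm_smul, Real.norm_eq_abs, abs_of_nonneg ht.1] at h1
  nlinarith [ht.2, norm_nonneg (y - x)]

/-- The points of `Q` from which all segments to `B` stay away from the origin. -/
def visibleSet {n : ℕ} (K : ℝ) (Q B : Set (Rn n)) : Set (Rn n) :=
  {x ∈ Q | ∀ y ∈ B, ∀ t ∈ Set.Icc (0 : ℝ) 1, ‖x‖ ≤ K * ‖x + t • (y - x)‖}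

/-- The intersection over y and t is uncountable, but each condition is closed in x. -/
theorem measurableSet_visibleSet {n : ℕ} (K : ℝ) {Q : Set (Rn n)} (hQ : MeasurableSet Q)
    (B : Set (Rn n)) : MeasurableSet (visibleSet K Q B) := by
  have h : IsClosed (⋂ y ∈ B, ⋂ t ∈ Set.Icc (0 : ℝ) 1,
      {x : Rn n | ‖x‖ ≤ K * ‖x + t • (y - x)‖}) :=
    isClosed_biInter fun y _ => isClosed_biInter fun t _ => isClosed_le (by fun_prop) (by fun_prop)
  have e : visibleSet K Q B = Q ∩ ⋂ y ∈ B, ⋂ t ∈ Set.Icc (0 : ℝ) 1,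
      {x : Rn n | ‖x‖ ≤ K * ‖x + t • (y - x)‖} := by
    ext x
    simp only [visibleSet, Set.mem_ofPred_eq, Set.mem_inter_iff, Set.mem_iInter]
  rw [e]
  exact hQ.inter h.measurableSet

/-- By transversality, `norm_le_of_wedge` forbids that x fails to see both subcubes. Points of the
first subcube see both: the two lie in a common half-space at distance at least l/16 from 0, so by
convexity do the segments joining them. -/
theorem exists_subcubes_visible {n : ℕ} (hn : 2 ≤ n) (c : Rn n) {l : ℝ} (hl : 0 < l) :
    ∃ b₁ b₂ : Rn n, (∀ k, |b₁ k - c k| ≤ 3 * l / 8) ∧ (∀ k, |b₂ k - c k| ≤ 3 * l / 8) ∧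
      (∀ y ∈ cube b₁ (l / 8), l / 16 ≤ ‖y‖) ∧
      cube c l ⊆ visibleSet (2000 * n) (cube c l) (cube b₁ (l / 8)) ∪
        visibleSet (2000 * n) (cube c l) (cube b₂ (l / 8)) ∧
      cube b₁ (l / 8) ⊆ visibleSet (2000 * n) (cube c l) (cube b₁ (l / 8)) ∧
      cube b₁ (l / 8) ⊆ visibleSet (2000 * n) (cube c l) (cube b₂ (l / 8)) := by
  obtain ⟨b₁, b₂, i, j, σ, hb₁, hb₂, hσ, hhalf, hw₀⟩ := exists_transversal_subcubes hn c hl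
  have hn1 : (2 : ℝ) ≤ n := by exact_mod_cast hn
  have hsub₁ : cube b₁ (l / 8) ⊆ cube c l := cube_subset_cube hb₁ (by linarith)
  have hsub₂ : cube b₂ (l / 8) ⊆ cube c l := cube_subset_cube hb₂ (by linarith)
  have habs : ∀ z : Rn n, σ * z j ≤ ‖z‖ := fun z =>
    calc σ * z j ≤ |σ * z j| := le_abs_self _
      _ = |z j| := by rw [abs_mul, hσ, one_mul]
      _ ≤ ‖z‖ := PiLp.norm_apply_le z j
  have hfar : ∀ x ∈ cube c l, 2 * (√n * l) ≤ ‖x‖ → ∀ y ∈ cube c l, ∀ t ∈ Set.Icc (0 : ℝ) 1,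
      ‖x‖ ≤ 2000 * n * ‖x + t • (y - x)‖ := by
    intro x hx h y hy t ht
    have := norm_le_two_mul_norm_add_smul (norm_sub_le_of_mem_cube hl hx hy) ht h
    nlinarith [norm_nonneg (x + t • (y - x))]
  have hsq : √(n : ℝ) ^ 2 = n := Real.sq_sqrt (by positivity)
  have hsqle : √(n : ℝ) ≤ n := by
    have : 1 ≤ √(n : ℝ) := Real.one_le_sqrt.mpr (by linarith)
    nlinarith
  have hnear : ∀ x ∈ cube b₁ (l / 8), ∀ y ∈ cube b₁ (l / 8) ∪ cube b₂ (l / 8),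
      ∀ t ∈ Set.Icc (0 : ℝ) 1, ‖x‖ ≤ 2000 * n * ‖x + t • (y - x)‖ := by
    intro x hx y hy t ht
    rcases le_total (2 * (√n * l)) ‖x‖ with h | h
    · exact hfar x (hsub₁ hx) h y (hy.elim (fun h => hsub₁ h) (fun h => hsub₂ h)) t ht
    · have h1 := hhalf x (Or.inl hx)
      have h2 := hhalf y hy
      have h3 := habs (x + t • (y - x))
      have h4 : σ * (x + t • (y - x)) j = (1 - t) * (σ * x j) + t * (σ * y j) := by
        simp only [PiLp.add_apply, PiLp.smul_apply, PiLp.sub_apply, smul_eq_mul]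
        ring
      have h5 : l / 16 ≤ ‖x + t • (y - x)‖ := by
        rw [h4] at h3
        nlinarith [ht.1, ht.2]
      calc ‖x‖ ≤ 2 * (n * l) := h.trans (by gcongr)
        _ ≤ 2000 * n * (l / 16) := by nlinarith
        _ ≤ _ := by gcongr
  refine ⟨b₁, b₂, hb₁, hb₂, fun y hy => (hhalf y (Or.inl hy)).trans (habs y), ?_,
    fun x hx => ⟨hsub₁ hx, fun y hy t ht => hnear x hx y (Or.inl hy) t ht⟩,
    fun x hx => ⟨hsub₁ hx, fun y hy t ht => hnear x hx y (Or.inr hy) t ht⟩⟩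
  intro x hx
  by_contra hcon
  simp only [visibleSet, Set.mem_union, Set.mem_ofPred_eq, hx, true_and, not_or, not_forall] at hcon
  obtain ⟨⟨y₁, hy₁, t₁, ht₁, h₁⟩, ⟨y₂, hy₂, t₂, ht₂, h₂⟩⟩ := hcon
  have hw := hw₀ y₁ hy₁ y₂ hy₂
  rcases norm_le_of_wedge (i := i) (j := j) (K := 2000 * n) (by linarith)
    (norm_sub_le_of_mem_cube hl hx (hsub₁ hy₁)) (norm_sub_le_of_mem_cube hl hx (hsub₂ hy₂))
    -- With D = √n·l and wedge at least l²/64, the choice K = 2000n works because 24 < 2000/64.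
    ht₁ ht₂ (by
      rw [mul_pow, hsq]
      have : 0 < (n : ℝ) * l ^ 2 := by positivity
      calc 24 * ((n : ℝ) * l ^ 2) < 2000 * n * (l ^ 2 / 64) := by nlinarith
        _ ≤ _ := by gcongr) with h | h
  · exact h₁ h
  · exact h₂ h

/-! ### Doubling of the power weights -/

/-- Stronger than doubling: 2Q is compared with a small subcube kept away from 0. If Q is far from 0
the weight is nearly constant on 2Q; otherwise 2Q lies in a ball about 0 of radius comparable to l,
whose mass is known by scaling. -/
theorem exists_weightMeasure_cube_two_mul_le {n : ℕ} (hn : 2 ≤ n) {a : ℝ} (ha : -(n : ℝ) < a) :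
    ∃ C : ℝ≥0, ∀ (c b : Rn n) (l : ℝ), 0 < l → (∀ k, |b k - c k| ≤ 3 * l / 8) →
      (∀ y ∈ cube b (l / 8), l / 16 ≤ ‖y‖) →
      weightMeasure (powerWeight n a) (cube c (2 * l)) ≤
        C * weightMeasure (powerWeight n a) (cube b (l / 8)) := by
  have hn0 : n ≠ 0 := by omega
  have hn1 : (2 : ℝ) ≤ n := by exact_mod_cast hn
  set I := ∫⁻ x in Metric.ball (0 : Rn n) 1, powerDensity n a x with hI
  have hIfin : I < ⊤ := setLIntegral_ball_powerDensity_lt_top hn0 ha 1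
  set s := √(n : ℝ) with hs
  have hs1 : 1 ≤ s := Real.one_le_sqrt.mpr (by linarith)
  set C1 := ENNReal.ofReal (2 ^ |a| * 16 ^ n * 2 ^ |a|)
  set C2 := ENNReal.ofReal ((96 * s) ^ |a|) * (ENNReal.ofReal ((48 * s) ^ n) * I)
  have hfin : C1 + C2 ≠ ⊤ := by finiteness
  refine ⟨(C1 + C2).toNNReal, fun c b l hl hb hlow => ?_⟩
  rw [ENNReal.coe_toNNReal hfin]
  have hm : ∀ c l, MeasurableSet (cube (n := n) c l) := fun c l => (isOpen_cube c l).measurableSet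
  rw [weightMeasure_powerWeight_apply a (hm _ _), weightMeasure_powerWeight_apply a (hm _ _)]
  have hsub : cube b (l / 8) ⊆ cube c (2 * l) := cube_subset_cube hb (by linarith)
  have hdist : ∀ x ∈ cube c (2 * l), ‖x - c‖ ≤ s * l := fun x hx => by
    simpa using norm_sub_center_le (by positivity) hx
  rw [add_mul]
  have hsl : 0 < s * l := by positivity
  rcases le_total (4 * (s * l)) ‖c‖ with hfar | hnear
  · refine le_add_right ?_
    have hcomp : ∀ x ∈ cube c (2 * l), x ≠ 0 ∧ ‖c‖ ≤ 2 * ‖x‖ ∧ ‖x‖ ≤ 2 * ‖c‖ := by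
      intro x hx
      have h1 := hdist x hx
      have h2 := norm_sub_norm_le x c
      have h3 := norm_sub_norm_le c x
      rw [norm_sub_rev c x] at h3
      refine ⟨?_, by linarith, by linarith⟩
      rw [← norm_pos_iff]
      linarith
    have hc0 : c ≠ 0 := by
      rw [← norm_pos_iff]
      linarith
    calc ∫⁻ x in cube c (2 * l), powerDensity n a x
        ≤ ∫⁻ _ in cube c (2 * l), ENNReal.ofReal (2 ^ |a|) * powerDensity n a c :=
          setLIntegral_mono' (hm _ _) fun x hx =>
            powerDensity_le_of_comparable a (hcomp x hx).1 (by norm_num) (hcomp x hx).2.1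
              (hcomp x hx).2.2
      _ = ENNReal.ofReal (2 ^ |a| * 16 ^ n) *
            ∫⁻ _ in cube b (l / 8), powerDensity n a c := by
          rw [setLIntegral_const, setLIntegral_const, volume_cube c (by positivity),
            volume_cube b (by positivity), ENNReal.ofReal_mul (by positivity)]
          have : ENNReal.ofReal ((2 * l) ^ n) =
              ENNReal.ofReal (16 ^ n) * ENNReal.ofReal ((l / 8) ^ n) := by
            rw [← ENNReal.ofReal_mul (by positivity), ← mul_pow]
            congr 2
            ring
          rw [this]
          ring
      _ ≤ ENNReal.ofReal (2 ^ |a| * 16 ^ n) *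
            ∫⁻ x in cube b (l / 8), ENNReal.ofReal (2 ^ |a|) * powerDensity n a x := by
          gcongr 1
          exact setLIntegral_mono' (hm _ _) fun x hx =>
            powerDensity_le_of_comparable a hc0 (by norm_num) (hcomp x (hsub hx)).2.2
              (hcomp x (hsub hx)).2.1
      _ = _ := by
          rw [lintegral_const_mul' _ _ ENNReal.ofReal_ne_top, ← mul_assoc,
            ← ENNReal.ofReal_mul (by positivity)]
  · refine le_add_left ?_
    have hball : ∀ x ∈ cube c (2 * l), ‖x‖ < 6 * (s * l) := by
      intro x hx
      have h1 := hdist x hx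
      have h2 := norm_sub_norm_le x c
      linarith
    set R := 6 * (s * l) with hR
    have hR0 : 0 < R := by positivity
    -- On the subcube l/16 ≤ |x| < R, and R/(l/16) = 96√n.
    have hlower : ENNReal.ofReal ((l / 8) ^ n) * ENNReal.ofReal (R ^ a) ≤
        ENNReal.ofReal ((96 * s) ^ |a|) * ∫⁻ x in cube b (l / 8), powerDensity n a x := by
      rw [← lintegral_const_mul' _ _ ENNReal.ofReal_ne_top, ← volume_cube b (by positivity),
        mul_comm, ← setLIntegral_const]
      refine setLIntegral_mono' (hm _ _) fun x hx => ?_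
      rw [powerDensity, ← ENNReal.ofReal_mul (by positivity)]
      refine ENNReal.ofReal_le_ofReal (rpow_le_rpow_abs_mul_rpow a hR0 (by linarith) ?_ ?_)
      · have := hball x (hsub hx)
        nlinarith
      · have := hlow x hx
        nlinarith
    calc ∫⁻ x in cube c (2 * l), powerDensity n a x
        ≤ ∫⁻ x in Metric.ball (0 : Rn n) R, powerDensity n a x :=
          lintegral_mono_set fun x hx => by simpa using hball x hx
      _ = ENNReal.ofReal ((48 * s) ^ n) * I *
            (ENNReal.ofReal ((l / 8) ^ n) * ENNReal.ofReal (R ^ a)) := by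
          rw [setLIntegral_ball_powerDensity a hR0, ENNReal.ofReal_mul (by positivity)]
          have : ENNReal.ofReal (R ^ n) =
              ENNReal.ofReal ((48 * s) ^ n) * ENNReal.ofReal ((l / 8) ^ n) := by
            rw [← ENNReal.ofReal_mul (by positivity), ← mul_pow, hR]
            congr 2
            ring
          rw [this]
          ring
      _ ≤ ENNReal.ofReal ((48 * s) ^ n) * I * (ENNReal.ofReal ((96 * s) ^ |a|) *
            ∫⁻ x in cube b (l / 8), powerDensity n a x) := by gcongr
      _ = _ := by ring

theorem powerDensity_pos {n : ℕ} (a : ℝ) {x : Rn n} (hx : x ≠ 0) : 0 < powerDensity n a x :=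
  ENNReal.ofReal_pos.mpr (Real.rpow_pos_of_pos (norm_pos_iff.mpr hx) a)

/-- The density is positive off the null set {0}, so weighted and Lebesgue null sets agree. Elements
of weighted L^p spaces can thus be tested for weak differentiability. -/
theorem ae_weightMeasure_powerWeight_iff {n : ℕ} (hn : n ≠ 0) (a : ℝ) {s : Set (Rn n)}
    (hs : MeasurableSet s) {P : Rn n → Prop} :
    (∀ᵐ x ∂(weightMeasure (powerWeight n a)).restrict s, P x) ↔ ∀ᵐ x ∂volume.restrict s, P x := by
  have := nontrivial_Rn hn
  rw [weightMeasure, restrict_withDensity hs,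
    ae_withDensity_iff (f := fun x => ENNReal.ofReal (powerWeight n a x))
      (measurable_powerDensity n a)]
  have h0 : ∀ᵐ x ∂volume.restrict s, x ≠ (0 : Rn n) := ae_restrict_of_ae (Measure.ae_ne volume 0)
  constructor
  · intro h
    filter_upwards [h, h0] with x hx h0
    exact hx (powerDensity_pos a h0).ne'
  · intro h
    filter_upwards [h] with x hx _
    exact hx

theorem cubesPosFinite_powerWeight {n : ℕ} (hn : n ≠ 0) {a : ℝ} (ha : -(n : ℝ) < a) :
    CubesPosFinite (weightMeasure (powerWeight n a)) := by
  intro c l hl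
  have hm : MeasurableSet (cube c l) := (isOpen_cube c l).measurableSet
  constructor
  · rw [pos_iff_ne_zero]
    intro h
    have h1 : ∀ᵐ x ∂(weightMeasure (powerWeight n a)).restrict (cube c l), False := by
      rw [Measure.restrict_eq_zero.mpr h]
      simp
    rw [ae_weightMeasure_powerWeight_iff hn a hm, eventually_false_iff_eq_bot, ae_eq_bot,
      Measure.restrict_eq_zero, volume_cube c hl, ENNReal.ofReal_eq_zero] at h1
    have : 0 < l ^ n := by positivity
    linarith
  · rw [weightMeasure_powerWeight_apply a hm]
    refine lt_of_le_of_lt (lintegral_mono_set ?_)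
      (setLIntegral_ball_powerDensity_lt_top hn ha (‖c‖ + √n * l))
    intro x hx
    have h1 := norm_sub_center_le hl hx
    have h2 := norm_sub_norm_le x c
    have hn' : 0 < √(n : ℝ) := Real.sqrt_pos.mpr (by positivity)
    have : 0 < √n * l := by positivity
    rw [mem_ball_zero_iff]
    linarith

theorem isDoubling_powerWeight {n : ℕ} (hn : 2 ≤ n) {a : ℝ} (ha : -(n : ℝ) < a) :
    IsDoubling (weightMeasure (powerWeight n a)) := by
  obtain ⟨C, hC⟩ := exists_weightMeasure_cube_two_mul_le hn ha
  refine ⟨cubesPosFinite_powerWeight (by omega) ha, C, fun c l hl => ?_⟩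
  obtain ⟨b, _, hb, _, hlow, _⟩ := exists_subcubes_visible hn c hl
  refine (hC c b l hl hb hlow).trans ?_
  gcongr
  exact cube_subset_cube hb (by linarith)

theorem isWeight_powerWeight {n : ℕ} (hn : n ≠ 0) {a : ℝ} (ha : -(n : ℝ) < a) :
    IsWeight (powerWeight n a) := by
  refine ⟨fun x => Real.rpow_nonneg (norm_nonneg x) a, fun x => ?_⟩
  refine ⟨Metric.ball 0 (‖x‖ + 1), Metric.isOpen_ball.mem_nhds (by simp), ?_⟩
  exact (integrableOn_ball_norm_rpow_iff hn (by positivity)).mpr ha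

/-! ### The Poincaré inequality for the power weights -/

theorem aestronglyMeasurable_of_contDiffOn {n : ℕ} {Q : Set (Rn n)} (hQ : IsOpen Q) {u : Rn n → ℝ}
    (hu : ContDiffOn ℝ ∞ u Q) (μ : Measure (Rn n)) : AEStronglyMeasurable u (μ.restrict Q) :=
  hu.continuousOn.aestronglyMeasurable hQ.measurableSet

theorem enorm_sub_average_mul_le {α : Type*} [MeasurableSpace α] {ν : Measure α}
    [IsFiniteMeasure ν] {u : α → ℝ} (hu : Integrable u ν) (m : ℝ) :
    ‖m - ⨍ y, u y ∂ν‖ₑ * ν Set.univ ≤ ∫⁻ y, ‖m - u y‖ₑ ∂ν := by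
  rcases eq_or_ne ν 0 with rfl | hν
  · simp
  have : NeZero ν := ⟨hν⟩
  have e : m - ⨍ y, u y ∂ν = ⨍ y, (m - u y) ∂ν := by
    rw [average_eq, average_eq, integral_sub (integrable_const m) hu, smul_sub, integral_const,
      smul_smul, inv_mul_cancel₀ (by simpa [measureReal_eq_zero_iff] using hν), one_smul]
  rw [e, average, mul_comm]
  calc ν Set.univ * ‖∫ y, (m - u y) ∂(ν Set.univ)⁻¹ • ν‖ₑ
      ≤ ν Set.univ * ∫⁻ y, ‖m - u y‖ₑ ∂(ν Set.univ)⁻¹ • ν := by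
        gcongr
        exact enorm_integral_le_lintegral_enorm _
    _ = ∫⁻ y, ‖m - u y‖ₑ ∂ν := by
        rw [lintegral_smul_measure, smul_eq_mul, ← mul_assoc,
          ENNReal.mul_inv_cancel (by simpa using hν) (measure_ne_top _ _), one_mul]

theorem lintegral_enorm_sub_average_le {α : Type*} [MeasurableSpace α] {ν : Measure α}
    [IsFiniteMeasure ν] {u : α → ℝ} (hu : Integrable u ν) (m : ℝ) :
    ∫⁻ x, ‖u x - ⨍ y, u y ∂ν‖ₑ ∂ν ≤ 2 * ∫⁻ x, ‖u x - m‖ₑ ∂ν := by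
  calc ∫⁻ x, ‖u x - ⨍ y, u y ∂ν‖ₑ ∂ν
      ≤ ∫⁻ x, (‖u x - m‖ₑ + ‖m - ⨍ y, u y ∂ν‖ₑ) ∂ν := by
        refine lintegral_mono fun x => ?_
        have : u x - ⨍ y, u y ∂ν = (u x - m) + (m - ⨍ y, u y ∂ν) := by ring
        rw [this]
        exact enorm_add_le _ _
    _ = (∫⁻ x, ‖u x - m‖ₑ ∂ν) + ‖m - ⨍ y, u y ∂ν‖ₑ * ν Set.univ := by
        rw [lintegral_add_right _ measurable_const, lintegral_const]
    _ ≤ (∫⁻ x, ‖u x - m‖ₑ ∂ν) + ∫⁻ x, ‖u x - m‖ₑ ∂ν := by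
        gcongr
        refine (enorm_sub_average_mul_le hu m).trans_eq ?_
        simp_rw [enorm_sub_rev m]
    _ = _ := (two_mul _).symm

theorem integrableOn_of_contDiffOn_of_bounded {n : ℕ} {Q : Set (Rn n)} (hQ : IsOpen Q)
    {u : Rn n → ℝ} (hu : ContDiffOn ℝ ∞ u Q) {M : ℝ} (hM : ∀ x ∈ Q, |u x| ≤ M)
    {μ : Measure (Rn n)} {B : Set (Rn n)} (hBQ : B ⊆ Q) (hB : MeasurableSet B) (hμ : μ B ≠ ⊤) :
    IntegrableOn u B μ :=
  IntegrableOn.of_bound hμ.lt_top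
    ((aestronglyMeasurable_of_contDiffOn hQ hu μ).mono_set hBQ) M (by
      filter_upwards [ae_restrict_mem hB] with x hx
      exact hM x (hBQ hx))

/-- The Poincaré inequality with exponent 1, with some constant m in place of the weighted mean.
Here m is the Lebesgue mean of u over the first subcube. -/
theorem exists_setLIntegral_powerDensity_mul_enorm_sub_le {n : ℕ} (hn : 2 ≤ n) {a : ℝ}
    (ha : -(n : ℝ) < a) :
    ∃ C : ℝ≥0, ∀ (c : Rn n) (l : ℝ), 0 < l → ∀ u : Rn n → ℝ, ContDiffOn ℝ ∞ u (cube c l) →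
      (∃ M : ℝ, ∀ x ∈ cube c l, |u x| ≤ M) →
      ∃ m : ℝ, ∫⁻ x in cube c l, powerDensity n a x * ‖u x - m‖ₑ ≤
        C * ENNReal.ofReal l * ∫⁻ x in cube c l, powerDensity n a x * ‖fderiv ℝ u x‖ₑ := by
  have hn0 : n ≠ 0 := by omega
  have hn1 : (2 : ℝ) ≤ n := by exact_mod_cast hn
  obtain ⟨C₀, hC₀⟩ := exists_setLIntegral_enorm_sub_le hn0 ha (K := 2000 * n) (by linarith)
  obtain ⟨C₁, hC₁⟩ := exists_weightMeasure_cube_two_mul_le hn ha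
  set s := √(n : ℝ) with hs
  have hs0 : 0 < s := Real.sqrt_pos.mpr (by linarith)
  -- The segment estimate gives (√n·l)^{n+1}, and dividing by the volume (l/8)^n of the subcube
  -- leaves 8^n √n^{n+1} l.
  set C₂ : ℝ≥0 := C₀ * (8 ^ n * s ^ (n + 1)).toNNReal with hC₂
  refine ⟨2 * C₂ + 2 * C₁ * C₂, fun c l hl u hu ⟨M, hM⟩ => ?_⟩
  set Q := cube c l with hQ
  have hQo : IsOpen Q := isOpen_cube c l
  have hm : ∀ c l, MeasurableSet (cube (n := n) c l) := fun c l => (isOpen_cube c l).measurableSet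
  set W := powerDensity n a with hW
  have hWm : Measurable W := measurable_powerDensity n a
  set G := ∫⁻ x in Q, W x * ‖fderiv ℝ u x‖ₑ with hG
  obtain ⟨b₁, b₂, hb₁, hb₂, hlow, hcover, hvis₁, hvis₂⟩ := exists_subcubes_visible hn c hl
  have hmain : ∀ b : Rn n, (∀ k, |b k - c k| ≤ 3 * l / 8) →
      ∃ m : ℝ, ∫⁻ x in visibleSet (2000 * n) Q (cube b (l / 8)), W x * ‖u x - m‖ₑ ≤
        C₂ * ENNReal.ofReal l * G := by
    intro b hb
    set B := cube b (l / 8) with hB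
    set E := visibleSet (2000 * n) Q B with hE
    have hBQ : B ⊆ Q := cube_subset_cube hb (by linarith)
    have hv : volume B = ENNReal.ofReal ((l / 8) ^ n) := volume_cube b (by positivity)
    have hint : IntegrableOn u B volume :=
      integrableOn_of_contDiffOn_of_bounded hQo hu hM hBQ (hm _ _) (by rw [hv]; finiteness)
    refine ⟨⨍ y in B, u y, ?_⟩
    have : IsFiniteMeasure (volume.restrict B) := ⟨by simp [hv]⟩
    have h1 := hC₀ (s * l) (by positivity) Q E B hQo (convex_cube c l)
      (measurableSet_visibleSet _ (hm _ _) _) (hm _ _) (fun x hx => hx.1) hBQ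
      (fun x hx y hy => norm_sub_le_of_mem_cube hl hx hy) (fun x hx => hx.2) u hu
    have h2 : ENNReal.ofReal ((l / 8) ^ n) * ∫⁻ x in E, W x * ‖u x - ⨍ y in B, u y‖ₑ ≤
        C₀ * ENNReal.ofReal ((s * l) ^ (n + 1)) * G := by
      refine le_trans ?_ h1
      rw [← lintegral_const_mul' _ _ ENNReal.ofReal_ne_top]
      refine lintegral_mono fun x => ?_
      have h3 := enorm_sub_average_mul_le hint (u x)
      rw [Measure.restrict_apply_univ, hv] at h3
      calc _ = W x * (‖u x - ⨍ y in B, u y‖ₑ * ENNReal.ofReal ((l / 8) ^ n)) := by ring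
        _ ≤ _ := by gcongr
    have h3 : ENNReal.ofReal ((s * l) ^ (n + 1)) = ENNReal.ofReal ((l / 8) ^ n) *
        (ENNReal.ofReal (8 ^ n * s ^ (n + 1)) * ENNReal.ofReal l) := by
      rw [← ENNReal.ofReal_mul (by positivity), ← ENNReal.ofReal_mul (by positivity)]
      congr 1
      rw [div_pow, mul_pow, pow_succ l]
      field_simp
    have hp : 0 < (l / 8) ^ n := by positivity
    have h4 : ENNReal.ofReal ((l / 8) ^ n) ≠ 0 := by simpa using hp
    refine (ENNReal.mul_le_mul_iff_right h4 ENNReal.ofReal_ne_top).mp (h2.trans_eq ?_)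
    rw [h3, hC₂, ENNReal.coe_mul, ← ENNReal.ofReal]
    ring
  obtain ⟨m₁, hm₁⟩ := hmain b₁ hb₁
  obtain ⟨m₂, hm₂⟩ := hmain b₂ hb₂
  refine ⟨m₁, ?_⟩
  set E₁ := visibleSet (2000 * n) Q (cube b₁ (l / 8))
  set E₂ := visibleSet (2000 * n) Q (cube b₂ (l / 8))
  set R := C₂ * ENNReal.ofReal l * G with hR
  have htri : ∀ (m m' r : ℝ), ‖m - m'‖ₑ ≤ ‖r - m‖ₑ + ‖r - m'‖ₑ := fun m m' r => by
    have : m - m' = (r - m') - (r - m) := by ring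
    rw [this, add_comm]
    exact enorm_sub_le
  -- Both means are close to u on the first subcube, which sees both subcubes and carries a fixed
  -- proportion of the mass of Q.
  have hjoin : ‖m₁ - m₂‖ₑ * ∫⁻ x in Q, W x ≤ C₁ * (2 * R) := by
    have h1 : ∫⁻ x in Q, W x ≤ C₁ * ∫⁻ x in cube b₁ (l / 8), W x := by
      have h2 := hC₁ c b₁ l hl hb₁ hlow
      rw [weightMeasure_powerWeight_apply a (hm _ _),
        weightMeasure_powerWeight_apply a (hm _ _)] at h2
      exact le_trans (lintegral_mono_set (cube_subset_cube (r := 0) (by simp) (by linarith))) h2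
    have hsm : AEMeasurable (fun x => W x * ‖u x - m₁‖ₑ)
        (volume.restrict (cube b₁ (l / 8))) := by
      have h3 := (aestronglyMeasurable_of_contDiffOn hQo hu volume).mono_set
        (hvis₁.trans fun x hx => hx.1)
      exact hWm.aemeasurable.mul (h3.aemeasurable.sub_const _).enorm
    calc ‖m₁ - m₂‖ₑ * ∫⁻ x in Q, W x
        ≤ ‖m₁ - m₂‖ₑ * (C₁ * ∫⁻ x in cube b₁ (l / 8), W x) := by gcongr
      _ = C₁ * ∫⁻ x in cube b₁ (l / 8), ‖m₁ - m₂‖ₑ * W x := by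
          rw [lintegral_const_mul' _ _ (by finiteness)]
          ring
      _ ≤ C₁ * ∫⁻ x in cube b₁ (l / 8), (W x * ‖u x - m₁‖ₑ + W x * ‖u x - m₂‖ₑ) := by
          gcongr with x
          rw [← mul_add, mul_comm]
          gcongr
          exact htri m₁ m₂ (u x)
      _ = C₁ * ((∫⁻ x in cube b₁ (l / 8), W x * ‖u x - m₁‖ₑ) +
            ∫⁻ x in cube b₁ (l / 8), W x * ‖u x - m₂‖ₑ) := by
          rw [lintegral_add_left' hsm]
      _ ≤ C₁ * (R + R) := by
          gcongr
          · exact (lintegral_mono_set hvis₁).trans hm₁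
          · exact (lintegral_mono_set hvis₂).trans hm₂
      _ = _ := by ring
  have hE₂ : ∫⁻ x in E₂, W x * ‖u x - m₁‖ₑ ≤ R + C₁ * (2 * R) := by
    calc ∫⁻ x in E₂, W x * ‖u x - m₁‖ₑ
        ≤ ∫⁻ x in E₂, (W x * ‖u x - m₂‖ₑ + ‖m₁ - m₂‖ₑ * W x) := by
          gcongr with x
          rw [mul_comm ‖m₁ - m₂‖ₑ, ← mul_add]
          gcongr
          have : u x - m₁ = (u x - m₂) - (m₁ - m₂) := by ring
          rw [this]
          exact enorm_sub_le
      _ = (∫⁻ x in E₂, W x * ‖u x - m₂‖ₑ) + ‖m₁ - m₂‖ₑ * ∫⁻ x in E₂, W x := by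
          rw [lintegral_add_right _ (hWm.const_mul _), lintegral_const_mul' _ _ (by finiteness)]
      _ ≤ R + ‖m₁ - m₂‖ₑ * ∫⁻ x in Q, W x := by
          gcongr
          exact fun x hx => hx.1
      _ ≤ _ := by gcongr
  calc ∫⁻ x in Q, W x * ‖u x - m₁‖ₑ
      ≤ ∫⁻ x in E₁ ∪ E₂, W x * ‖u x - m₁‖ₑ := lintegral_mono_set hcover
    _ ≤ (∫⁻ x in E₁, W x * ‖u x - m₁‖ₑ) + ∫⁻ x in E₂, W x * ‖u x - m₁‖ₑ := lintegral_union_le _ _ _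
    _ ≤ R + (R + C₁ * (2 * R)) := by gcongr
    _ = _ := by
        rw [hR]
        push_cast
        ring

theorem enorm_gradient {n : ℕ} (u : Rn n → ℝ) (x : Rn n) : ‖∇ u x‖ₑ = ‖fderiv ℝ u x‖ₑ := by
  rw [gradient, LinearIsometryEquiv.enorm_map]

/-- Jensen's inequality, which carries the Poincaré inequality from exponent 1 to p. -/
theorem lintegral_enorm_le_rpow {α : Type*} [MeasurableSpace α] {ν : Measure α}
    [IsProbabilityMeasure ν] {g : α → ℝ≥0∞} (hg : AEMeasurable g ν) {p : ℝ} (hp : 1 ≤ p) :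
    ∫⁻ x, g x ∂ν ≤ (∫⁻ x, g x ^ p ∂ν) ^ (1 / p) := by
  have := eLpNorm'_le_eLpNorm'_of_exponent_le (μ := ν) zero_lt_one hp hg.aestronglyMeasurable
  simpa [eLpNorm'] using this

theorem hasPoincare_powerWeight {n : ℕ} (hn : 2 ≤ n) {a p : ℝ} (ha : -(n : ℝ) < a) (hp : 1 ≤ p) :
    HasPoincare p (weightMeasure (powerWeight n a)) := by
  have hn0 : n ≠ 0 := by omega
  obtain ⟨C, hC⟩ := exists_setLIntegral_powerDensity_mul_enorm_sub_le hn ha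
  have hpos := cubesPosFinite_powerWeight hn0 ha
  refine ⟨hpos, 4 * C, fun c l hl u hu hb => ?_⟩
  set μ := weightMeasure (powerWeight n a) with hμ
  set Q := cube c l with hQ
  have hQm : MeasurableSet Q := (isOpen_cube c l).measurableSet
  obtain ⟨hμ0, hμt⟩ := hpos c l hl
  obtain ⟨M, hM⟩ := hb
  obtain ⟨m, hm⟩ := hC c l hl u hu ⟨M, hM⟩
  have hfin : IsFiniteMeasure (μ.restrict Q) := ⟨by simpa using hμt⟩
  have hne : NeZero (μ.restrict Q) := ⟨by
    rw [Ne, Measure.restrict_eq_zero]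
    exact hμ0.ne'⟩
  have hint : Integrable u (μ.restrict Q) :=
    integrableOn_of_contDiffOn_of_bounded (isOpen_cube c l) hu hM subset_rfl hQm hμt.ne
  rw [← setLIntegral_weightMeasure_powerWeight a hQm,
    ← setLIntegral_weightMeasure_powerWeight a hQm] at hm
  have hgm : AEMeasurable (fun x => ‖fderiv ℝ u x‖ₑ) (μ.restrict Q) :=
    ((hu.continuousOn_fderiv_of_isOpen (isOpen_cube c l) (by simp)).enorm.aemeasurable hQm)
  calc ⨍⁻ x in Q, ‖u x - ⨍ y in Q, u y ∂μ‖ₑ ∂μ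
      = (∫⁻ x in Q, ‖u x - ⨍ y in Q, u y ∂μ‖ₑ ∂μ) / μ Q := setLAverage_eq _ _ _
    _ ≤ (2 * ∫⁻ x in Q, ‖u x - m‖ₑ ∂μ) / μ Q := by
        gcongr
        exact lintegral_enorm_sub_average_le hint m
    _ ≤ (2 * (C * ENNReal.ofReal l * ∫⁻ x in Q, ‖fderiv ℝ u x‖ₑ ∂μ)) / μ Q := by gcongr
    _ = 2 * C * ENNReal.ofReal l * ⨍⁻ x in Q, ‖fderiv ℝ u x‖ₑ ∂μ := by
        rw [setLAverage_eq, ENNReal.div_eq_inv_mul, ENNReal.div_eq_inv_mul]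
        ring
    _ ≤ 2 * C * ENNReal.ofReal (2 * Metric.diam Q) *
          (⨍⁻ x in Q, ‖fderiv ℝ u x‖ₑ ^ p ∂μ) ^ (1 / p) := by
        gcongr
        · exact le_two_mul_diam_cube hn0 c hl
        · exact lintegral_enorm_le_rpow (hgm.mono_ac (Measure.AbsolutelyContinuous.smul_left
            Measure.AbsolutelyContinuous.rfl _)) hp
    _ = _ := by
        simp_rw [enorm_gradient]
        rw [ENNReal.ofReal_mul (by norm_num), ENNReal.ofReal_ofNat]
        push_cast
        ring

theorem isAdmissibleWeight_powerWeight {n : ℕ} (hn : 2 ≤ n) {a p : ℝ} (ha : -(n : ℝ) < a)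
    (hp : 1 ≤ p) : IsAdmissibleWeight p (powerWeight n a) :=
  ⟨isWeight_powerWeight (by omega) ha, isDoubling_powerWeight hn ha,
    hasPoincare_powerWeight hn ha hp⟩

/-! ### Weak partial derivatives of smooth functions -/

theorem setIntegral_eq_integral_of_tsupport_subset {n : ℕ} {Ω : Set (Rn n)} {φ g : Rn n → ℝ}
    (hs : tsupport φ ⊆ Ω) (h : ∀ x, x ∉ tsupport φ → g x = 0) : ∫ x in Ω, g x = ∫ x, g x :=
  setIntegral_eq_integral_of_forall_compl_eq_zero fun x hx => h x fun hx' => hx (hs hx')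

theorem fderiv_eq_zero_of_notMem_tsupport {n : ℕ} {φ : Rn n → ℝ} {x : Rn n} (hx : x ∉ tsupport φ) :
    fderiv ℝ φ x = 0 := by
  by_contra h
  exact hx (support_fderiv_subset ℝ h)

theorem isWeakPartialDeriv_of_contDiffOn {n : ℕ} {Ω : Set (Rn n)} (hΩ : IsOpen Ω) {u : Rn n → ℝ}
    (hu : ContDiffOn ℝ ∞ u Ω) (j : Fin n) :
    IsWeakPartialDeriv Ω j u (fun x => fderiv ℝ u x (EuclideanSpace.single j 1)) := by
  have h1 : LocallyIntegrableOn u Ω volume :=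
    hu.continuousOn.locallyIntegrableOn hΩ.measurableSet
  have h2 : LocallyIntegrableOn (fun x => fderiv ℝ u x (EuclideanSpace.single j 1)) Ω volume :=
    ((hu.continuousOn_fderiv_of_isOpen hΩ (by simp)).clm_apply
      continuousOn_const).locallyIntegrableOn hΩ.measurableSet
  refine ⟨h1, h2, fun φ hφ hc hs => ?_⟩
  have z1 : ∀ x, x ∉ tsupport φ → u x * fderiv ℝ φ x (EuclideanSpace.single j 1) = 0 :=
    fun x hx => by simp [fderiv_eq_zero_of_notMem_tsupport hx]
  have z2 : ∀ x, x ∉ tsupport φ → fderiv ℝ u x (EuclideanSpace.single j 1) * φ x = 0 :=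
    fun x hx => by simp [image_eq_zero_of_notMem_tsupport hx]
  have z3 : ∀ x, x ∉ tsupport φ → u x * φ x = 0 :=
    fun x hx => by simp [image_eq_zero_of_notMem_tsupport hx]
  rw [setIntegral_eq_integral_of_tsupport_subset hs z1,
    setIntegral_eq_integral_of_tsupport_subset hs z2]
  refine integral_mul_fderiv_eq_neg_fderiv_mul_of_integrable ?_ ?_ ?_ ?_ ?_
  · exact (integrableOn_mul_self h2 hφ hc hs).integrable_of_forall_notMem_eq_zero
      fun x hx => z2 x fun h => hx (hs h)
  · exact (integrableOn_mul_fderiv h1 hφ hc hs _).integrable_of_forall_notMem_eq_zero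
      fun x hx => z1 x fun h => hx (hs h)
  · exact (integrableOn_mul_self h1 hφ hc hs).integrable_of_forall_notMem_eq_zero
      fun x hx => z3 x fun h => hx (hs h)
  · exact fun x hx => (hu.contDiffAt (hΩ.mem_nhds (hs hx))).differentiableAt (by simp)
  · exact fun x _ => (hφ.differentiable (by simp)) x

theorem IsWeakPartialDeriv.mono {n : ℕ} {Ω U : Set (Rn n)} {j : Fin n} {u v : Rn n → ℝ}
    (h : IsWeakPartialDeriv Ω j u v) (hU : U ⊆ Ω) : IsWeakPartialDeriv U j u v where
  locallyIntegrableOn := h.locallyIntegrableOn.mono_set hU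
  locallyIntegrableOn_deriv := h.locallyIntegrableOn_deriv.mono_set hU
  integral_eq φ hφ hc hs := by
    have z1 : ∀ x, x ∉ tsupport φ → u x * fderiv ℝ φ x (EuclideanSpace.single j 1) = 0 :=
      fun x hx => by simp [fderiv_eq_zero_of_notMem_tsupport hx]
    have z2 : ∀ x, x ∉ tsupport φ → v x * φ x = 0 :=
      fun x hx => by simp [image_eq_zero_of_notMem_tsupport hx]
    have := h.integral_eq φ hφ hc (hs.trans hU)
    rw [setIntegral_eq_integral_of_tsupport_subset (hs.trans hU) z1,
      setIntegral_eq_integral_of_tsupport_subset (hs.trans hU) z2] at this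
    rw [setIntegral_eq_integral_of_tsupport_subset hs z1,
      setIntegral_eq_integral_of_tsupport_subset hs z2, this]

/-- The difference of the two derivatives annihilates every test function, so the fundamental lemma
of the calculus of variations applies. -/
theorem IsWeakPartialDeriv.ae_eq {n : ℕ} {Ω : Set (Rn n)} (hΩ : IsOpen Ω) {j : Fin n}
    {u₁ u₂ v₁ v₂ : Rn n → ℝ} (h₁ : IsWeakPartialDeriv Ω j u₁ v₁)
    (h₂ : IsWeakPartialDeriv Ω j u₂ v₂) (hu : u₁ =ᵐ[volume.restrict Ω] u₂) :
    v₁ =ᵐ[volume.restrict Ω] v₂ := by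
  have key := hΩ.ae_eq_zero_of_integral_contDiff_smul_eq_zero
    (h₁.locallyIntegrableOn_deriv.sub h₂.locallyIntegrableOn_deriv) (fun φ hφ hc hs => by
      have z : ∀ x, x ∉ tsupport φ → φ x • (v₁ - v₂) x = 0 :=
        fun x hx => by simp [image_eq_zero_of_notMem_tsupport hx]
      rw [← setIntegral_eq_integral_of_tsupport_subset hs z]
      have e : ∀ x, φ x • (v₁ - v₂) x = v₁ x * φ x - v₂ x * φ x := fun x => by
        simp only [Pi.sub_apply, smul_eq_mul]
        ring
      simp only [e]
      rw [integral_sub (integrableOn_mul_self h₁.2 hφ hc hs)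
        (integrableOn_mul_self h₂.2 hφ hc hs)]
      have e1 := h₁.integral_eq φ hφ hc hs
      have e2 := h₂.integral_eq φ hφ hc hs
      have e3 : ∫ x in Ω, u₁ x * fderiv ℝ φ x (EuclideanSpace.single j 1) =
          ∫ x in Ω, u₂ x * fderiv ℝ φ x (EuclideanSpace.single j 1) := by
        refine integral_congr_ae ?_
        filter_upwards [hu] with x hx
        rw [hx]
      linarith)
  rw [EventuallyEq, ae_restrict_iff' hΩ.measurableSet]
  filter_upwards [key] with x hx hxΩ
  exact sub_eq_zero.mp (hx hxΩ)

/-! ### The regularizations of `|x|^{1-n}` -/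

/-- The function `(|x|² + ε)^{(1-n)/2}`. -/
def radialReg (n : ℕ) (ε : ℝ) : Rn n → ℝ := fun x => (‖x‖ ^ 2 + ε) ^ ((1 - (n : ℝ)) / 2)

/-- With the limit as the member ε = 0 of the family, bounds stated for ε ≥ 0 apply to it as well.
-/
theorem radialReg_zero (n : ℕ) : radialReg n 0 = radialFun n := by
  ext x
  rw [radialReg, radialFun, add_zero, ← Real.rpow_natCast, ← Real.rpow_mul (norm_nonneg x)]
  congr 1
  push_cast
  ring

theorem contDiffAt_radialReg {n : ℕ} {ε : ℝ} {x : Rn n} (h : 0 < ‖x‖ ^ 2 + ε) :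
    ContDiffAt ℝ ∞ (radialReg n ε) x :=
  ((contDiff_norm_sq ℝ).contDiffAt.add contDiffAt_const).rpow_const_of_ne h.ne'

theorem contDiff_radialReg (n : ℕ) {ε : ℝ} (hε : 0 < ε) : ContDiff ℝ ∞ (radialReg n ε) :=
  contDiff_iff_contDiffAt.mpr fun x => contDiffAt_radialReg (by positivity)

theorem fderiv_radialReg {n : ℕ} {ε : ℝ} {x : Rn n} (h : 0 < ‖x‖ ^ 2 + ε) :
    fderiv ℝ (radialReg n ε) x =
      ((1 - (n : ℝ)) / 2 * (‖x‖ ^ 2 + ε) ^ ((1 - (n : ℝ)) / 2 - 1)) • (2 • innerSL ℝ x) := by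
  have h1 : HasFDerivAt (fun x : Rn n => ‖x‖ ^ 2 + ε) (2 • innerSL ℝ x) x :=
    (hasStrictFDerivAt_norm_sq x).hasFDerivAt.add_const ε
  exact (h1.rpow_const (Or.inl h.ne')).fderiv

theorem radialReg_nonneg {n : ℕ} {ε : ℝ} (hε : 0 ≤ ε) (x : Rn n) : 0 ≤ radialReg n ε x :=
  Real.rpow_nonneg (by positivity) _

theorem radialReg_le {n : ℕ} (hn : n ≠ 0) {ε : ℝ} (hε : 0 ≤ ε) {x : Rn n} (hx : x ≠ 0) :
    radialReg n ε x ≤ ‖x‖ ^ (1 - (n : ℝ)) := by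
  have hx0 : 0 < ‖x‖ := norm_pos_iff.mpr hx
  have h1 : (1 : ℝ) ≤ n := by exact_mod_cast Nat.one_le_iff_ne_zero.mpr hn
  have := congrFun (radialReg_zero n) x
  rw [radialFun] at this
  rw [← this, radialReg, radialReg, add_zero]
  exact Real.rpow_le_rpow_of_nonpos (by positivity) (by linarith) (by linarith)

theorem norm_fderiv_radialReg_le {n : ℕ} (hn : n ≠ 0) {ε : ℝ} (hε : 0 ≤ ε) {x : Rn n}
    (hx : x ≠ 0) : ‖fderiv ℝ (radialReg n ε) x‖ ≤ n * ‖x‖ ^ (-(n : ℝ)) := by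
  have hx0 : 0 < ‖x‖ := norm_pos_iff.mpr hx
  have h1 : (1 : ℝ) ≤ n := by exact_mod_cast Nat.one_le_iff_ne_zero.mpr hn
  rw [fderiv_radialReg (by positivity), norm_smul, norm_mul, Real.norm_eq_abs, Real.norm_eq_abs,
    abs_of_nonpos (by linarith), abs_of_nonneg (by positivity)]
  have h2 : ‖(2 • innerSL ℝ x : Rn n →L[ℝ] ℝ)‖ = 2 * ‖x‖ := by
    rw [← Nat.cast_smul_eq_nsmul ℝ, norm_smul, innerSL_apply_norm]
    simp
  have h3 : (‖x‖ ^ 2 + ε) ^ ((1 - (n : ℝ)) / 2 - 1) ≤ ‖x‖ ^ (-(n : ℝ) - 1) := by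
    calc (‖x‖ ^ 2 + ε) ^ ((1 - (n : ℝ)) / 2 - 1) ≤ (‖x‖ ^ 2) ^ ((1 - (n : ℝ)) / 2 - 1) :=
          Real.rpow_le_rpow_of_nonpos (by positivity) (by linarith) (by linarith)
      _ = ‖x‖ ^ (-(n : ℝ) - 1) := by
          rw [← Real.rpow_natCast, ← Real.rpow_mul hx0.le]
          congr 1
          push_cast
          ring
  have h4 : ‖x‖ ^ (-(n : ℝ)) = ‖x‖ ^ (-(n : ℝ) - 1) * ‖x‖ := by
    rw [Real.rpow_sub_one hx0.ne']
    field_simp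
  rw [h2, h4]
  calc -((1 - (n : ℝ)) / 2) * (‖x‖ ^ 2 + ε) ^ ((1 - (n : ℝ)) / 2 - 1) * (2 * ‖x‖)
      = ((n : ℝ) - 1) * ((‖x‖ ^ 2 + ε) ^ ((1 - (n : ℝ)) / 2 - 1) * ‖x‖) := by ring
    _ ≤ n * (‖x‖ ^ (-(n : ℝ) - 1) * ‖x‖) := by
        gcongr
        linarith

/-- Euler's relation for a function homogeneous of degree 1 - n. -/
theorem fderiv_radialFun_self {n : ℕ} {x : Rn n} (hx : x ≠ 0) :
    fderiv ℝ (radialFun n) x x = (1 - (n : ℝ)) * ‖x‖ ^ (-(n : ℝ)) * ‖x‖ := by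
  have hx0 : 0 < ‖x‖ := norm_pos_iff.mpr hx
  rw [← radialReg_zero, fderiv_radialReg (by positivity)]
  have e : (‖x‖ ^ 2) ^ ((1 - (n : ℝ)) / 2 - 1) = ‖x‖ ^ (-(n : ℝ)) * ‖x‖⁻¹ := by
    rw [← Real.rpow_natCast, ← Real.rpow_mul hx0.le, ← Real.rpow_neg_one ‖x‖,
      ← Real.rpow_add hx0]
    congr 1
    push_cast
    ring
  simp only [_root_.smul_apply, innerSL_apply_apply, real_inner_self_eq_norm_sq,
    add_zero, e, smul_eq_mul, nsmul_eq_mul]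
  field_simp
  push_cast
  ring

theorem contDiffOn_radialFun (n : ℕ) : ContDiffOn ℝ ∞ (radialFun n) ({0}ᶜ) := by
  rw [← radialReg_zero]
  intro x hx
  have hx0 : 0 < ‖x‖ := norm_pos_iff.mpr hx
  exact (contDiffAt_radialReg (by positivity)).contDiffWithinAt

/-- Euler's relation gives (n-1)|x|^{-n} as a lower bound for the sum, and n - 1 ≥ 1. -/
theorem norm_rpow_neg_le_sum {n : ℕ} (hn : 2 ≤ n) {x : Rn n} (hx : x ≠ 0) :
    ‖x‖ ^ (-(n : ℝ)) ≤ ∑ j, |fderiv ℝ (radialFun n) x (EuclideanSpace.single j 1)| := by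
  have hx0 : 0 < ‖x‖ := norm_pos_iff.mpr hx
  have hn1 : (2 : ℝ) ≤ n := by exact_mod_cast hn
  have e : x = ∑ j, x j • EuclideanSpace.single j (1 : ℝ) := by
    ext i
    simp [Finset.sum_apply, Pi.single_apply]
  have h1 : fderiv ℝ (radialFun n) x x =
      ∑ j, x j * fderiv ℝ (radialFun n) x (EuclideanSpace.single j 1) := by
    conv_lhs => arg 2; rw [e]
    simp
  have h2 : |fderiv ℝ (radialFun n) x x| ≤
      ‖x‖ * ∑ j, |fderiv ℝ (radialFun n) x (EuclideanSpace.single j 1)| := by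
    rw [h1, Finset.mul_sum]
    refine (Finset.abs_sum_le_sum_abs _ _).trans (Finset.sum_le_sum fun j _ => ?_)
    rw [abs_mul]
    gcongr
    exact PiLp.norm_apply_le x j
  rw [fderiv_radialFun_self hx, abs_mul, abs_mul, abs_of_nonpos (by linarith),
    abs_of_pos (by positivity), abs_of_pos hx0, mul_comm] at h2
  have h3 := le_of_mul_le_mul_left h2 hx0
  have h4 : 0 < ‖x‖ ^ (-(n : ℝ)) := by positivity
  nlinarith

/-! ### Failure of weak differentiability -/

/-- Off the origin the weak derivatives must be the classical ones. Their local integrability at 0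
would make |x|^{-n} integrable there, which is the excluded borderline exponent. -/
theorem not_isWeaklyDifferentiable_of_ae_eq_radialFun {n : ℕ} (hn : 2 ≤ n) {Ω : Set (Rn n)}
    {r : ℝ} (hr : 0 < r) (hΩ : Metric.ball 0 r ⊆ Ω) {u : Rn n → ℝ}
    (hu : u =ᵐ[volume.restrict (Metric.ball 0 r)] radialFun n) :
    ¬ IsWeaklyDifferentiable Ω u := by
  rintro ⟨-, hv⟩
  choose v hv using hv
  have hn0 : n ≠ 0 := by omega
  have := nontrivial_Rn hn0
  set U : Set (Rn n) := Metric.ball 0 r ∩ {0}ᶜ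
  have hU : IsOpen U := Metric.isOpen_ball.inter isOpen_compl_singleton
  have hae : ∀ j, v j =ᵐ[volume.restrict U]
      fun x => fderiv ℝ (radialFun n) x (EuclideanSpace.single j 1) := fun j =>
    ((hv j).mono (Set.inter_subset_left.trans hΩ)).ae_eq hU
      (isWeakPartialDeriv_of_contDiffOn hU
        ((contDiffOn_radialFun n).mono Set.inter_subset_right) j)
      (ae_restrict_of_ae_restrict_of_subset Set.inter_subset_left hu)
  have hK : Metric.closedBall (0 : Rn n) (r / 2) ⊆ Ω :=
    (Metric.closedBall_subset_ball (by linarith)).trans hΩ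
  have hsum : IntegrableOn (fun x => ∑ j, |v j x|) (Metric.ball 0 (r / 2)) volume := by
    refine integrable_finsetSum _ fun j _ => ?_
    exact (((hv j).locallyIntegrableOn_deriv.integrableOn_compact_subset hK
      (isCompact_closedBall _ _)).mono_set Metric.ball_subset_closedBall).abs
  have hint : IntegrableOn (fun x : Rn n => ‖x‖ ^ (-(n : ℝ))) (Metric.ball 0 (r / 2)) volume := by
    refine hsum.mono' (measurable_norm_rpow _).aestronglyMeasurable ?_
    have h0 : ∀ᵐ x ∂volume.restrict (Metric.ball (0 : Rn n) (r / 2)), x ≠ 0 :=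
      ae_restrict_of_ae (Measure.ae_ne volume 0)
    have h1 : ∀ᵐ x ∂volume.restrict (Metric.ball (0 : Rn n) (r / 2)), ∀ j, x ∈ U →
        v j x = fderiv ℝ (radialFun n) x (EuclideanSpace.single j 1) :=
      ae_restrict_of_ae (ae_all_iff.mpr fun j => (ae_restrict_iff' hU.measurableSet).mp (hae j))
    filter_upwards [h0, h1, ae_restrict_mem Metric.isOpen_ball.measurableSet] with x hx0 hx1 hxb
    have hxU : x ∈ U := ⟨Metric.ball_subset_ball (by linarith) hxb, hx0⟩
    rw [Real.norm_of_nonneg (by positivity)]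
    refine (norm_rpow_neg_le_sum hn hx0).trans_eq (Finset.sum_congr rfl fun j _ => ?_)
    rw [hx1 j hxU]
  exact lt_irrefl _ ((integrableOn_ball_norm_rpow_iff hn0 (by positivity)).mp hint)

/-! ### Approximation of `η |x|^{1-n}` by smooth functions -/

/-- Dominated convergence for the p-th power of the difference, which is at most (2H)^p. -/
theorem tendsto_eLpNorm_sub_of_dominated {α E : Type*} [MeasurableSpace α] [NormedAddCommGroup E]
    {ν : Measure α} {q : ℝ≥0∞} (hq0 : q ≠ 0) (hq : q ≠ ⊤) {F : ℕ → α → E} {f : α → E} {H : α → ℝ}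
    (hF : ∀ k, AEStronglyMeasurable (F k) ν) (hf : AEStronglyMeasurable f ν) (hH : MemLp H q ν)
    (hFH : ∀ k, ∀ᵐ x ∂ν, ‖F k x‖ ≤ H x) (hfH : ∀ᵐ x ∂ν, ‖f x‖ ≤ H x)
    (hlim : ∀ᵐ x ∂ν, Tendsto (fun k => F k x) atTop (𝓝 (f x))) :
    Tendsto (fun k => eLpNorm (fun x => F k x - f x) q ν) atTop (𝓝 0) := by
  have hq' : 0 < q.toReal := ENNReal.toReal_pos hq0 hq
  have hH2 : ∫⁻ x, ‖(2 : ℝ) * H x‖ₑ ^ q.toReal ∂ν ≠ ⊤ :=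
    (lintegral_rpow_enorm_lt_top_of_eLpNorm_lt_top hq0 hq (hH.const_mul 2).2).ne
  have key : Tendsto (fun k => ∫⁻ x, ‖F k x - f x‖ₑ ^ q.toReal ∂ν) atTop
      (𝓝 (∫⁻ _, 0 ∂ν)) := by
    refine tendsto_lintegral_of_dominated_convergence' _
      (fun k => ((hF k).sub hf).enorm.pow_const _) (fun k => ?_) hH2 ?_
    · filter_upwards [hFH k, hfH] with x h1 h2
      gcongr
      rw [enorm_le_iff_norm_le]
      calc ‖F k x - f x‖ ≤ ‖F k x‖ + ‖f x‖ := norm_sub_le _ _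
        _ ≤ 2 * H x := by linarith
        _ ≤ ‖2 * H x‖ := le_abs_self _
    · filter_upwards [hlim] with x hx
      have h1 : Tendsto (fun k => ‖F k x - f x‖ₑ) atTop (𝓝 0) := by
        have := (hx.sub_const (f x)).enorm
        simpa using this
      have h2 := ((ENNReal.continuous_rpow_const (y := q.toReal)).tendsto 0).comp h1
      simpa [Function.comp_def, ENNReal.zero_rpow_of_pos hq'] using h2
  simp only [eLpNorm_eq_lintegral_rpow_enorm_toReal hq0 hq]
  have h3 := ((ENNReal.continuous_rpow_const (y := 1 / q.toReal)).tendsto _).comp key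
  simpa [Function.comp_def, ENNReal.zero_rpow_of_pos (inv_pos.mpr hq')] using h3

/-- The condition a > n(p-1) enters here: it says a - np > -n, so |x|^{-np}|x|^a is integrable near
0. -/
theorem memLp_indicator_norm_rpow {n : ℕ} (hn : n ≠ 0) {p a : ℝ} (hp : 1 ≤ p)
    (ha : (n : ℝ) * (p - 1) < a) (C R : ℝ) :
    MemLp ((Metric.ball (0 : Rn n) R).indicator fun x => C * ‖x‖ ^ (-(n : ℝ)))
      (ENNReal.ofReal p) (weightMeasure (powerWeight n a)) := by
  have := nontrivial_Rn hn
  have hm : MeasurableSet (Metric.ball (0 : Rn n) R) := Metric.isOpen_ball.measurableSet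
  have hp0 : 0 < p := by linarith
  rw [memLp_indicator_iff_restrict hm]
  refine MemLp.const_mul ?_ C
  refine ⟨(measurable_norm_rpow _).aestronglyMeasurable, ?_⟩
  rw [eLpNorm_lt_top_iff_lintegral_rpow_enorm_lt_top (by simpa using hp0) ENNReal.ofReal_ne_top,
    ENNReal.toReal_ofReal hp0.le, setLIntegral_weightMeasure_powerWeight a hm]
  refine lt_of_le_of_lt (lintegral_mono_ae ?_)
    (setLIntegral_ball_powerDensity_lt_top hn (a := a - n * p) (by nlinarith) R)
  filter_upwards [ae_restrict_of_ae (Measure.ae_ne volume (0 : Rn n))] with x hx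
  have hx0 : 0 < ‖x‖ := norm_pos_iff.mpr hx
  rw [Real.enorm_of_nonneg (by positivity), powerDensity, powerDensity,
    ENNReal.ofReal_rpow_of_nonneg (by positivity) hp0.le, ← ENNReal.ofReal_mul (by positivity),
    ← Real.rpow_mul hx0.le, ← Real.rpow_add hx0]
  refine le_of_eq ?_
  congr 2
  ring

theorem differentiableAt_radialReg {n : ℕ} {ε : ℝ} {x : Rn n} (h : 0 < ‖x‖ ^ 2 + ε) :
    DifferentiableAt ℝ (radialReg n ε) x :=
  (contDiffAt_radialReg h).differentiableAt (by simp)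

theorem gradient_apply {n : ℕ} (u : Rn n → ℝ) (x : Rn n) (j : Fin n) :
    (∇ u x) j = fderiv ℝ u x (EuclideanSpace.single j 1) := by
  have h : inner ℝ (∇ u x) (EuclideanSpace.single j 1) =
      fderiv ℝ u x (EuclideanSpace.single j 1) := by
    rw [gradient, InnerProductSpace.toDual_symm_apply]
  rw [← h, EuclideanSpace.inner_single_right]
  simp

theorem norm_gradient {n : ℕ} (u : Rn n → ℝ) (x : Rn n) : ‖∇ u x‖ = ‖fderiv ℝ u x‖ := by
  rw [gradient, LinearIsometryEquiv.norm_map]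

theorem aestronglyMeasurable_gradient {n : ℕ} (u : Rn n → ℝ) (ν : Measure (Rn n)) :
    AEStronglyMeasurable (∇ u) ν :=
  ((InnerProductSpace.toDual ℝ (Rn n)).symm.continuous.measurable.comp
    (measurable_fderiv ℝ u)).aestronglyMeasurable

theorem fderiv_mul_radialReg {n : ℕ} {η : Rn n → ℝ} (hη : ContDiff ℝ ∞ η) {ε : ℝ} {x : Rn n}
    (h : 0 < ‖x‖ ^ 2 + ε) :
    fderiv ℝ (fun x => η x * radialReg n ε x) x =
      η x • fderiv ℝ (radialReg n ε) x + radialReg n ε x • fderiv ℝ η x :=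
  fderiv_fun_mul (hη.differentiable (by simp) x) (differentiableAt_radialReg h)

theorem exists_bound_mul_radialReg {n : ℕ} (hn : n ≠ 0) {η : Rn n → ℝ} (hη : ContDiff ℝ ∞ η)
    (hc : HasCompactSupport η) :
    ∃ C R : ℝ, ∀ ε : ℝ, 0 ≤ ε → ∀ x : Rn n, x ≠ 0 →
      ‖η x * radialReg n ε x‖ ≤
        (Metric.ball (0 : Rn n) R).indicator (fun x => C * ‖x‖ ^ (-(n : ℝ))) x ∧
      ‖∇ (fun x => η x * radialReg n ε x) x‖ ≤
        (Metric.ball (0 : Rn n) R).indicator (fun x => C * ‖x‖ ^ (-(n : ℝ))) x := by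
  obtain ⟨M₁, hM₁⟩ := hc.exists_bound_of_continuous hη.continuous
  obtain ⟨M₂, hM₂⟩ := (hc.fderiv (𝕜 := ℝ)).exists_bound_of_continuous
    (hη.continuous_fderiv (by simp))
  obtain ⟨R, hR⟩ := hc.isCompact.isBounded.subset_ball (0 : Rn n)
  -- On the ball |x|^{1-n} ≤ |R||x|^{-n}, so function and gradient share one dominating power. The
  -- absolute value is there because the sign of R is unknown.
  refine ⟨M₁ * |R| + M₁ * n + |R| * M₂, R, fun ε hε x hx => ?_⟩
  have hx0 : 0 < ‖x‖ := norm_pos_iff.mpr hx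
  have hM₁0 : 0 ≤ M₁ := (norm_nonneg _).trans (hM₁ 0)
  have hM₂0 : 0 ≤ M₂ := (norm_nonneg _).trans (hM₂ 0)
  have hpos : 0 < ‖x‖ ^ 2 + ε := by positivity
  rw [norm_gradient, fderiv_mul_radialReg hη hpos]
  by_cases hxR : x ∈ Metric.ball (0 : Rn n) R
  · simp only [Set.indicator_of_mem hxR]
    have hxR' : ‖x‖ ≤ |R| := (mem_ball_zero_iff.mp hxR).le.trans (le_abs_self R)
    have b0 : ‖radialReg n ε x‖ ≤ |R| * ‖x‖ ^ (-(n : ℝ)) := by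
      rw [Real.norm_of_nonneg (radialReg_nonneg hε x)]
      refine (radialReg_le hn hε hx).trans ?_
      rw [sub_eq_add_neg, Real.rpow_add hx0, Real.rpow_one]
      gcongr
    have b1 := norm_fderiv_radialReg_le hn hε hx
    have hX : 0 < ‖x‖ ^ (-(n : ℝ)) := by positivity
    set X := ‖x‖ ^ (-(n : ℝ))
    have hR0 := abs_nonneg R
    have p1 : 0 ≤ M₁ * |R| * X := by positivity
    have p2 : 0 ≤ M₁ * n * X := by positivity
    have p3 : 0 ≤ |R| * M₂ * X := by positivity
    constructor
    · calc ‖η x * radialReg n ε x‖ = ‖η x‖ * ‖radialReg n ε x‖ := norm_mul _ _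
        _ ≤ M₁ * (|R| * X) := by gcongr; exact hM₁ x
        _ ≤ _ := by linarith
    · calc ‖η x • fderiv ℝ (radialReg n ε) x + radialReg n ε x • fderiv ℝ η x‖
          ≤ ‖η x‖ * ‖fderiv ℝ (radialReg n ε) x‖ + ‖radialReg n ε x‖ * ‖fderiv ℝ η x‖ := by
            refine (norm_add_le _ _).trans ?_
            rw [norm_smul, norm_smul]
        _ ≤ M₁ * (n * X) + |R| * X * M₂ := by
            gcongr
            · exact hM₁ x
            · exact hM₂ x
        _ ≤ _ := by linarith
  · have hxt : x ∉ tsupport η := fun h => hxR (hR h)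
    simp [Set.indicator_of_notMem hxR, image_eq_zero_of_notMem_tsupport hxt,
      fderiv_eq_zero_of_notMem_tsupport hxt]

theorem tendsto_radialReg {n : ℕ} {x : Rn n} (hx : x ≠ 0) :
    Tendsto (fun ε => radialReg n ε x) (𝓝 0) (𝓝 (radialFun n x)) := by
  have hx0 : 0 < ‖x‖ := norm_pos_iff.mpr hx
  rw [← radialReg_zero]
  have h : ContinuousAt (fun ε => radialReg n ε x) 0 :=
    (continuousAt_const.add continuousAt_id).rpow_const (Or.inl (by simp [hx]))
  exact h

theorem tendsto_gradient_mul_radialReg {n : ℕ} {η : Rn n → ℝ} (hη : ContDiff ℝ ∞ η) {x : Rn n}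
    (hx : x ≠ 0) {ε : ℕ → ℝ} (hε : ∀ k, 0 < ε k) (hε0 : Tendsto ε atTop (𝓝 0)) :
    Tendsto (fun k => ∇ (fun x => η x * radialReg n (ε k) x) x) atTop
      (𝓝 (∇ (fun x => η x * radialFun n x) x)) := by
  have hx0 : 0 < ‖x‖ := norm_pos_iff.mpr hx
  refine ((InnerProductSpace.toDual ℝ (Rn n)).symm.continuous.tendsto _).comp ?_
  have h1 : Tendsto (fun k => fderiv ℝ (radialReg n (ε k)) x) atTop
      (𝓝 (fderiv ℝ (radialReg n 0) x)) := by
    rw [fderiv_radialReg (by positivity)]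
    simp_rw [fun k => fderiv_radialReg (n := n) (x := x) (ε := ε k)
      (by have := hε k; positivity)]
    refine Tendsto.smul_const (Tendsto.const_mul _ ?_) _
    have h : ContinuousAt (fun ε : ℝ => (‖x‖ ^ 2 + ε) ^ ((1 - (n : ℝ)) / 2 - 1)) 0 :=
      (continuousAt_const.add continuousAt_id).rpow_const (Or.inl (by simp [hx]))
    exact h.tendsto.comp hε0
  have h2 := (tendsto_radialReg hx).comp hε0
  rw [← radialReg_zero, fderiv_mul_radialReg hη (by positivity)]
  simp_rw [fun k => fderiv_mul_radialReg (x := x) (ε := ε k) hη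
    (by have := hε k; positivity)]
  rw [radialReg_zero n] at h1 ⊢
  exact (h1.const_smul (η x)).add (h2.smul_const _)

theorem ae_ne_zero_weightMeasure {n : ℕ} (hn : n ≠ 0) (a : ℝ) :
    ∀ᵐ x ∂weightMeasure (powerWeight n a), x ≠ 0 := by
  have := nontrivial_Rn hn
  exact (withDensity_absolutelyContinuous _ _).ae_le (Measure.ae_ne volume 0)

/-- `η |x|^{1-n}` and its classical gradient are the `L^p` limits of smooth compactly supported
functions and their gradients. -/
theorem exists_smooth_approximation {n : ℕ} (hn : n ≠ 0) {p a : ℝ} (hp : 1 ≤ p)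
    (ha : (n : ℝ) * (p - 1) < a) {η : Rn n → ℝ} (hη : ContDiff ℝ ∞ η) (hc : HasCompactSupport η)
    (Ω : Set (Rn n)) :
    MemLp (fun x => η x * radialFun n x) (ENNReal.ofReal p)
      ((weightMeasure (powerWeight n a)).restrict Ω) ∧
    MemLp (∇ (fun x => η x * radialFun n x)) (ENNReal.ofReal p)
      ((weightMeasure (powerWeight n a)).restrict Ω) ∧
    ∃ f : ℕ → Rn n → ℝ,
      (∀ k, ContDiff ℝ ∞ (f k) ∧
        MemLp (f k) (ENNReal.ofReal p) ((weightMeasure (powerWeight n a)).restrict Ω) ∧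
        MemLp (∇ (f k)) (ENNReal.ofReal p) ((weightMeasure (powerWeight n a)).restrict Ω)) ∧
      Tendsto (fun k => eLpNorm (fun x => f k x - η x * radialFun n x) (ENNReal.ofReal p)
        ((weightMeasure (powerWeight n a)).restrict Ω)) atTop (𝓝 0) ∧
      Tendsto (fun k => eLpNorm (fun x => ∇ (f k) x - ∇ (fun x => η x * radialFun n x) x)
        (ENNReal.ofReal p) ((weightMeasure (powerWeight n a)).restrict Ω)) atTop (𝓝 0) := by
  set ν := (weightMeasure (powerWeight n a)).restrict Ω
  obtain ⟨C, R, hCR⟩ := exists_bound_mul_radialReg hn hη hc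
  set H := (Metric.ball (0 : Rn n) R).indicator (fun x => C * ‖x‖ ^ (-(n : ℝ)))
  have hH : MemLp H (ENNReal.ofReal p) ν := (memLp_indicator_norm_rpow hn hp ha C R).restrict Ω
  have h0 : ∀ᵐ x ∂ν, x ≠ 0 := ae_restrict_of_ae (ae_ne_zero_weightMeasure hn a)
  have hb : ∀ ε, 0 ≤ ε → (∀ᵐ x ∂ν, ‖η x * radialReg n ε x‖ ≤ H x) ∧
      ∀ᵐ x ∂ν, ‖∇ (fun x => η x * radialReg n ε x) x‖ ≤ H x := fun ε hε =>
    ⟨h0.mono fun x hx => (hCR ε hε x hx).1, h0.mono fun x hx => (hCR ε hε x hx).2⟩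
  have hmeas : ∀ ε, AEStronglyMeasurable (fun x => η x * radialReg n ε x) ν := fun ε => by
    have h1 : Measurable (radialReg n ε) := ((measurable_norm.pow_const 2).add_const ε).pow_const _
    exact (hη.continuous.measurable.mul h1).aestronglyMeasurable
  have hL : ∀ ε, 0 ≤ ε → MemLp (fun x => η x * radialReg n ε x) (ENNReal.ofReal p) ν ∧
      MemLp (∇ (fun x => η x * radialReg n ε x)) (ENNReal.ofReal p) ν := fun ε hε =>
    ⟨hH.mono' (hmeas ε) (hb ε hε).1, hH.mono' (aestronglyMeasurable_gradient _ _) (hb ε hε).2⟩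
  have hL0 := hL 0 le_rfl
  have hb0 := hb 0 le_rfl
  have hm0 := hmeas 0
  rw [radialReg_zero] at hL0 hb0 hm0
  set ε : ℕ → ℝ := fun k => 1 / ((k : ℝ) + 1)
  have hε : ∀ k, 0 < ε k := fun k => by positivity
  have hε0 : Tendsto ε atTop (𝓝 0) := tendsto_one_div_add_atTop_nhds_zero_nat
  have hq0 : ENNReal.ofReal p ≠ 0 := by
    rw [Ne, ENNReal.ofReal_eq_zero]
    linarith
  refine ⟨hL0.1, hL0.2, fun k x => η x * radialReg n (ε k) x, fun k =>
    ⟨hη.mul (contDiff_radialReg n (hε k)), hL _ (hε k).le⟩, ?_, ?_⟩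
  · refine tendsto_eLpNorm_sub_of_dominated hq0 ENNReal.ofReal_ne_top (fun k => hmeas (ε k)) hm0 hH
      (fun k => (hb _ (hε k).le).1) hb0.1 ?_
    filter_upwards [h0] with x hx
    exact ((tendsto_radialReg hx).comp hε0).const_mul (η x)
  · refine tendsto_eLpNorm_sub_of_dominated hq0 ENNReal.ofReal_ne_top
      (fun k => aestronglyMeasurable_gradient _ _) (aestronglyMeasurable_gradient _ _) hH
      (fun k => (hb _ (hε k).le).2) hb0.2 ?_
    filter_upwards [h0] with x hx
    exact tendsto_gradient_mul_radialReg hη hx hε hε0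

theorem memH_mul_radialFun {n : ℕ} (hn : n ≠ 0) {p a : ℝ} (hp : 1 ≤ p)
    (ha : (n : ℝ) * (p - 1) < a) {η : Rn n → ℝ} (hη : ContDiff ℝ ∞ η) (hc : HasCompactSupport η)
    (Ω : Set (Rn n)) : MemH p Ω (powerWeight n a) (fun x => η x * radialFun n x) := by
  obtain ⟨hu, hv, f, hf, h1, h2⟩ := exists_smooth_approximation hn hp ha hη hc Ω
  exact ⟨hu, _, hv, f, fun k => ⟨(hf k).1.contDiffOn, (hf k).2⟩, h1, h2⟩

theorem MemH.congr_ae {n : ℕ} {p : ℝ} {Ω : Set (Rn n)} {w u u' : Rn n → ℝ} (h : MemH p Ω w u)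
    (hu : u =ᵐ[(weightMeasure w).restrict Ω] u') : MemH p Ω w u' := by
  obtain ⟨hL, v, hv, f, hf, h1, h2⟩ := h
  refine ⟨hL.ae_eq hu, v, hv, f, hf, ?_, h2⟩
  refine h1.congr fun k => eLpNorm_congr_ae ?_
  filter_upwards [hu] with x hx
  rw [hx]

/-! ### Properties of the weighted Sobolev spaces -/

theorem isWeakGradient_of_contDiffOn {n : ℕ} {Ω : Set (Rn n)} (hΩ : IsOpen Ω) {u : Rn n → ℝ}
    (hu : ContDiffOn ℝ ∞ u Ω) : IsWeakGradient Ω u (∇ u) := by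
  refine ⟨hu.continuousOn.locallyIntegrableOn hΩ.measurableSet, fun j => ?_⟩
  simp_rw [gradient_apply]
  exact isWeakPartialDeriv_of_contDiffOn hΩ hu j

theorem IsWeakGradient.isWeaklyDifferentiable {n : ℕ} {Ω : Set (Rn n)} {u : Rn n → ℝ}
    {v : Rn n → Rn n} (h : IsWeakGradient Ω u v) : IsWeaklyDifferentiable Ω u :=
  ⟨h.1, fun j => ⟨_, h.2 j⟩⟩

/-- Only a.e. equality is required, because limits in W and extensions across 0 are known only up to
null sets. -/
theorem not_isWeaklyDifferentiable_of_ae_eq_mul_radialFun {n : ℕ} (hn : 2 ≤ n) {η : Rn n → ℝ}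
    (hη1 : ∀ᶠ x in 𝓝 0, η x = 1) {u : Rn n → ℝ} (hu : u =ᵐ[volume] fun x => η x * radialFun n x) :
    ¬ IsWeaklyDifferentiable Set.univ u := by
  obtain ⟨r, hr, hball⟩ := Metric.eventually_nhds_iff_ball.mp hη1
  refine not_isWeaklyDifferentiable_of_ae_eq_radialFun hn hr (Set.subset_univ _) ?_
  filter_upwards [ae_restrict_of_ae hu, ae_restrict_mem Metric.isOpen_ball.measurableSet]
    with x hx hxb
  rw [hx, hball x hxb, one_mul]

theorem exists_cutoff (n : ℕ) : ∃ η : Rn n → ℝ, ContDiff ℝ ∞ η ∧ HasCompactSupport η ∧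
    ∀ x ∈ Metric.ball (0 : Rn n) 1, η x = 1 := by
  let η : ContDiffBump (0 : Rn n) := ⟨1, 2, one_pos, one_lt_two⟩
  exact ⟨η, η.contDiff, η.hasCompactSupport, fun x hx =>
    η.one_of_mem_closedBall (Metric.ball_subset_closedBall hx)⟩

theorem memH_ball_radialFun {n : ℕ} (hn : n ≠ 0) {p a : ℝ} (hp : 1 ≤ p)
    (ha : (n : ℝ) * (p - 1) < a) : MemH p (Metric.ball 0 1) (powerWeight n a) (radialFun n) := by
  obtain ⟨η, hη, hc, hη1⟩ := exists_cutoff n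
  refine (memH_mul_radialFun hn hp ha hη hc (Metric.ball 0 1)).congr_ae ?_
  filter_upwards [ae_restrict_mem Metric.isOpen_ball.measurableSet] with x hx
  rw [hη1 x hx, one_mul]

theorem not_memW_ball_radialFun {n : ℕ} (hn : 2 ≤ n) (p a : ℝ) :
    ¬ MemW p (Metric.ball 0 1) (powerWeight n a) (radialFun n) := fun ⟨_, hv, _⟩ =>
  not_isWeaklyDifferentiable_of_ae_eq_radialFun hn one_pos subset_rfl (ae_eq_refl _)
    hv.isWeaklyDifferentiable

theorem not_completeSpace_W1p {n : ℕ} (hn : 2 ≤ n) {p a : ℝ} [hp : Fact (1 ≤ p)]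
    (ha : (n : ℝ) * (p - 1) < a) : ¬ CompleteSpace (W1p p Set.univ (powerWeight n a)) := by
  intro hcomplete
  have hn0 : n ≠ 0 := by omega
  obtain ⟨η, hη, hc, hη1⟩ := exists_cutoff n
  obtain ⟨hu, hv, f, hf, h1, h2⟩ :=
    exists_smooth_approximation hn0 hp.out ha hη hc (Set.univ : Set (Rn n))
  -- A complete subspace is closed, so the limit of the smooth approximations, taken in the product
  -- of L^p spaces, would have a weakly differentiable representative.
  have hclosed := (completeSpace_coe_iff_isComplete.mp hcomplete).isClosed
  have t1 := (Lp.tendsto_Lp_iff_tendsto_eLpNorm'' f (fun k => (hf k).2.1) _ hu).mpr h1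
  have t2 := (Lp.tendsto_Lp_iff_tendsto_eLpNorm'' (fun k => ∇ (f k)) (fun k => (hf k).2.2) _
    hv).mpr h2
  have t := ((WithLp.prod_continuous_toLp (ENNReal.ofReal p) _ _).tendsto _).comp
    (t1.prodMk_nhds t2)
  obtain ⟨u', v', h', hu', -⟩ := hclosed.mem_of_tendsto t (Eventually.of_forall fun k =>
    ⟨f k, ∇ (f k), isWeakGradient_of_contDiffOn isOpen_univ (hf k).1.contDiffOn,
      (hf k).2.1.coeFn_toLp, (hf k).2.2.coeFn_toLp⟩)
  refine not_isWeaklyDifferentiable_of_ae_eq_mul_radialFun hn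
    (Filter.mem_of_superset (Metric.ball_mem_nhds 0 one_pos) hη1) ?_ h'.isWeaklyDifferentiable
  have h3 := hu'.symm.trans hu.coeFn_toLp
  have h4 := (ae_weightMeasure_powerWeight_iff hn0 a MeasurableSet.univ).mp h3
  rwa [Measure.restrict_univ] at h4

/-- η|x|^{1-n} is smooth off 0, so there its classical gradient is its weak gradient and is
p-integrable. Since {0} is null, an extension would agree with it a.e. on the whole space. -/
theorem not_isRemovableW_singleton_zero {n : ℕ} (hn : 2 ≤ n) {p a : ℝ} (hp : 1 ≤ p)
    (ha : (n : ℝ) * (p - 1) < a) : ¬ IsRemovableW p Set.univ (powerWeight n a) {0} := by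
  intro hrem
  have hn0 : n ≠ 0 := by omega
  have := nontrivial_Rn hn0
  obtain ⟨η, hη, hc, hη1⟩ := exists_cutoff n
  have hopen : IsOpen (Set.univ \ {0} : Set (Rn n)) := isOpen_univ.sdiff isClosed_singleton
  obtain ⟨hu, hv, -⟩ := exists_smooth_approximation hn0 hp ha hη hc (Set.univ \ {0} : Set (Rn n))
  obtain ⟨u', ⟨v', h', -⟩, hu'⟩ := hrem _ ⟨_, isWeakGradient_of_contDiffOn hopen
    (hη.contDiffOn.mul ((contDiffOn_radialFun n).mono fun x hx => hx.2)), hu, hv⟩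
  refine not_isWeaklyDifferentiable_of_ae_eq_mul_radialFun hn
    (Filter.mem_of_superset (Metric.ball_mem_nhds 0 one_pos) hη1) ?_ h'.isWeaklyDifferentiable
  have h4 := (ae_weightMeasure_powerWeight_iff hn0 a hopen.measurableSet).mp hu'
  rw [ae_restrict_iff' hopen.measurableSet] at h4
  filter_upwards [h4, Measure.ae_ne volume (0 : Rn n)] with x hx hx0
  exact hx ⟨trivial, hx0⟩

end WeightedSobolev

end

/-! ### Assembly of statements A and B -/

theorem mainTheorem5 (n : ℕ) (hn : 2 ≤ n) (p : ℝ) [Fact (1 ≤ p)] :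
    -- the power weights and the function `|x|^{1-n}` on the unit ball
    (∀ γ : ℝ, -(n : ℝ) < γ →
      WeightedSobolev.IsAdmissibleWeight p (WeightedSobolev.powerWeight n γ) ∧
      ¬ WeightedSobolev.MemW p (Metric.ball 0 1) (WeightedSobolev.powerWeight n γ)
        (WeightedSobolev.radialFun n) ∧
      ((n : ℝ) * (p - 1) < γ →
        WeightedSobolev.MemH p (Metric.ball 0 1) (WeightedSobolev.powerWeight n γ)
          (WeightedSobolev.radialFun n))) ∧
    -- the three properties of the weight on `ℝⁿ`
    (∀ γ : ℝ, (n : ℝ) * (p - 1) < γ →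
      WeightedSobolev.IsAdmissibleWeight p (WeightedSobolev.powerWeight n γ) ∧
      ¬ CompleteSpace (WeightedSobolev.W1p p Set.univ (WeightedSobolev.powerWeight n γ)) ∧
      ((∃ u : WeightedSobolev.Rn n → ℝ,
          WeightedSobolev.MemH p Set.univ (WeightedSobolev.powerWeight n γ) u ∧
          ¬ WeightedSobolev.IsWeaklyDifferentiable Set.univ u) ∧
        ∀ η : WeightedSobolev.Rn n → ℝ, ContDiff ℝ ∞ η → HasCompactSupport η →
          (∀ᶠ x in 𝓝 0, η x = 1) →
          WeightedSobolev.MemH p Set.univ (WeightedSobolev.powerWeight n γ)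
            (fun x => η x * WeightedSobolev.radialFun n x) ∧
          ¬ WeightedSobolev.IsWeaklyDifferentiable Set.univ
            (fun x => η x * WeightedSobolev.radialFun n x)) ∧
      ¬ WeightedSobolev.IsRemovableW p Set.univ (WeightedSobolev.powerWeight n γ) {0}) := by
  have hp : 1 ≤ p := Fact.out
  have hn0 : n ≠ 0 := by omega
  have hbound : ∀ γ : ℝ, (n : ℝ) * (p - 1) < γ → -(n : ℝ) < γ := fun γ hγ => by
    have h1 : (2 : ℝ) ≤ n := by exact_mod_cast hn
    nlinarith
  refine ⟨fun γ hγ => ⟨WeightedSobolev.isAdmissibleWeight_powerWeight hn hγ hp,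
    WeightedSobolev.not_memW_ball_radialFun hn p γ,
    WeightedSobolev.memH_ball_radialFun hn0 hp⟩, fun γ hγ =>
    ⟨WeightedSobolev.isAdmissibleWeight_powerWeight hn (hbound γ hγ) hp,
      WeightedSobolev.not_completeSpace_W1p hn hγ, ?_,
      WeightedSobolev.not_isRemovableW_singleton_zero hn hp hγ⟩⟩
  have key : ∀ η : WeightedSobolev.Rn n → ℝ, ContDiff ℝ ∞ η → HasCompactSupport η →
      (∀ᶠ x in 𝓝 0, η x = 1) →
      WeightedSobolev.MemH p Set.univ (WeightedSobolev.powerWeight n γ)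
        (fun x => η x * WeightedSobolev.radialFun n x) ∧
      ¬ WeightedSobolev.IsWeaklyDifferentiable Set.univ
        (fun x => η x * WeightedSobolev.radialFun n x) := fun η hη hc hη1 =>
    ⟨WeightedSobolev.memH_mul_radialFun hn0 hp hγ hη hc Set.univ,
      WeightedSobolev.not_isWeaklyDifferentiable_of_ae_eq_mul_radialFun hn hη1 (ae_eq_refl _)⟩
  obtain ⟨η, hη, hc, hη1⟩ := WeightedSobolev.exists_cutoff n
  exact ⟨⟨_, key η hη hc (Filter.mem_of_superset (Metric.ball_mem_nhds 0 one_pos) hη1)⟩, key⟩
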